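/- **Setting.** Let $G$ be a simple graph on $n\ge 2$ vertices $V=\{0,\dots,n-1\}$ with $m$ edges, and let $k\ge 1$ be an integer. For a graph $H$ write $e(H)$ for its number of edges and $\Delta(H)$ for its maximum degree, and put $\tau(H)=\dfrac{e(H)}{k^4\lceil\log_2 n\rceil}$. *Stage I.* Start with $H=G$. As long as $\Delta(H)>\tau(H)$, remove from $H$ all vertices $v$ with $\deg_H(v)>\tau(H)/2$. Let $C\subseteq V$ be the set of all vertices removed when this stops. *Stage II.* Assign each vertex of $V\setminus C$ independently and uniformly at random to one of $k$ buckets, and let $V_1,\dots,V_k$ be the buckets. *Model.* Algorithms run in the work-depth model with arbitrary forking: threads with private registers and a shared memory execute word-RAM instructions (reads and writes, addition, truncated subtraction, multiplication, division and comparison of words, reading a word of a random tape), and a thread may fork any number of child threads and wait for them; threads running in parallel have to be free of data races. Words are the integers in $[0,W)$, and arithmetic is modulo $W$. Work is the total number of instructions executed, and depth (span) is the length of the longest chain of dependent instructions. The input consists of $n$, $k$ and an adjacency array of $G$; the first $n$ words of the random tape are independent and uniform over $k$ values. The output consists of the indicator function of $C$ and of the bucket of each vertex of $V\setminus C$. **Theorem.**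 There are a program and constants $A,c$ such that, for all $a\in\mathbb N$ and $K\in\mathbb R$, there are $b\in\mathbb N$ and $B\in\mathbb R$ such that, for every $\gamma>0$, there is $D\in\mathbb R$ such that the following holds for all $n\ge2$, all $1\le k\le K(\log n)^a$ and all $G$ as above. 1. For every adjacency array of $G$, every $W\ge (n+k)^c$ and every outcome of the random choices, the program halts, its output is exactly the pair $(C,\{V_1,\dots,V_k\})$ computed by Stages I and II (the bucket of each $v\in V\setminus C$ being the one given by the $v$-th word of the tape), its work is at most $A(n+m)$, and its depth is at most $B(\log n)^b$. 2. With probability at least $1-n^{-\gamma}$, the pair $(C,\{V_1,\dots,V_k\})$ is a culled balanced partition of $G$: $|C|\le B(\log n)^b$, the sets $V_1,\dots,V_k$ (some of which may be empty) are pairwise disjoint with union $V\setminus C$, and every induced subgraph $G[V_i]$ has at most $D\,m/k^2$ edges. -/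

import Mathlib

/-! ## The machine model

The work-depth model with arbitrary forking: threads with private registers operate on a shared
memory by word-RAM instructions, and may fork any number of child threads, for whose completion the
parent waits.  The shared memory is organised in arrays; cell `i` of array `A` is `(A, i)`.  Words
are natural numbers below `W`, so that a word has `log₂ W` bits, and arithmetic is modulo `W`.
Randomness comes from a read-only tape of random words. -/

namespace ParRAM

/-- Binary word operations.  Subtraction is truncated at `0`; comparisons return `0` or `1`. -/
inductive Op where
  | add | sub | mul | div | lt | eq

def Op.apply (W : ℕ) : Op → ℕ → ℕ → ℕ
  | .add, x, y => (x + y) % W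
  | .sub, x, y => x - y
  | .mul, x, y => (x * y) % W
  | .div, x, y => x / y
  | .lt, x, y => if x < y then 1 else 0
  | .eq, x, y => if x = y then 1 else 0

/-- Expressions: constants, private registers, word operations, reads `A[e]` of the shared memory,
and reads of the `e`-th word of the random tape. -/
inductive Exp where
  | lit (c : ℕ)
  | reg (x : ℕ)
  | op (o : Op) (e f : Exp)
  | get (A : ℕ) (e : Exp)
  | rand (e : Exp)

/-- Programs.  `fork x e c` spawns one thread for every `i < e`; thread `i` runs `c` on a private
copy of the registers of its parent in which register `x` holds `i`; the parent continues, with its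
own registers, when all of them have finished. -/
inductive Prog where
  | skip
  | set (x : ℕ) (e : Exp)
  | put (A : ℕ) (i e : Exp)
  | seq (c d : Prog)
  | ite (e : Exp) (c d : Prog)
  | loop (e : Exp) (c : Prog)
  | fork (x : ℕ) (e : Exp) (c : Prog)

/-- The private registers of a thread together with the shared memory. -/
structure State where
  reg : ℕ → ℕ
  mem : ℕ × ℕ → ℕ

namespace Exp

/-- The value of an expression, for word bound `W` and random tape `ρ`. -/
def eval (W : ℕ) (ρ : ℕ → ℕ) (s : State) : Exp → ℕ
  | lit c => c % W
  | reg x => s.reg x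
  | op o e f => o.apply W (e.eval W ρ s) (f.eval W ρ s)
  | get A e => s.mem (A, e.eval W ρ s)
  | rand e => ρ (e.eval W ρ s)

/-- The number of instructions that evaluate an expression. -/
def size : Exp → ℕ
  | lit _ => 1
  | reg _ => 1
  | op _ e f => e.size + f.size + 1
  | get _ e => e.size + 1
  | rand e => e.size + 1

/-- The memory cells read by the evaluation of an expression. -/
def reads (W : ℕ) (ρ : ℕ → ℕ) (s : State) : Exp → Set (ℕ × ℕ)
  | lit _ => ∅
  | reg _ => ∅
  | op _ e f => e.reads W ρ s ∪ f.reads W ρ s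
  | get A e => insert (A, e.eval W ρ s) (e.reads W ρ s)
  | rand e => e.reads W ρ s

end Exp

/-- What is recorded about an execution: its work (the number of instructions executed), its depth
(the length of the longest chain of dependent instructions), and the cells it read and wrote. -/
structure Cost where
  work : ℕ
  depth : ℕ
  reads : Set (ℕ × ℕ)
  writes : Set (ℕ × ℕ)

/-- The cost of evaluating `e` and performing one instruction on the result. -/
def stepCost (W : ℕ) (ρ : ℕ → ℕ) (s : State) (e : Exp) : Cost :=
  ⟨e.size + 1, e.size + 1, e.reads W ρ s, ∅⟩

/-- Sequential composition. -/
def Cost.andThen (p q : Cost) : Cost :=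
  ⟨p.work + q.work, p.depth + q.depth, p.reads ∪ q.reads, p.writes ∪ q.writes⟩

/-- Parallel composition of the costs `p 0, …, p (N - 1)`; spawning a thread is one instruction. -/
def Cost.par (N : ℕ) (p : ℕ → Cost) : Cost where
  work := ∑ i ∈ Finset.range N, ((p i).work + 1)
  depth := (Finset.range N).sup fun i => (p i).depth + 1
  reads := {l | ∃ i < N, l ∈ (p i).reads}
  writes := {l | ∃ i < N, l ∈ (p i).writes}

/-- Threads `0, …, N - 1` are free of data races: a cell written by one of them is neither read nor
written by another. -/
def RaceFree (N : ℕ) (p : ℕ → Cost) : Prop :=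
  ∀ i < N, ∀ j < N, i ≠ j → Disjoint (p i).writes ((p j).reads ∪ (p j).writes)

/-- `Exec W ρ c s t p`: started in state `s`, the program `c` halts in state `t` at cost `p`.
A program whose threads race has no execution, so the outcome of a `fork` does not depend on how its
threads are scheduled: each of them sees the memory at the time of the fork and its own writes, and
afterwards a cell holds what the thread that wrote it, if any, has left there. -/
inductive Exec (W : ℕ) (ρ : ℕ → ℕ) : Prog → State → State → Cost → Prop
  | skip (s : State) : Exec W ρ .skip s s ⟨1, 1, ∅, ∅⟩
  | set (x : ℕ) (e : Exp) (s : State) :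
      Exec W ρ (.set x e) s ⟨Function.update s.reg x (e.eval W ρ s), s.mem⟩ (stepCost W ρ s e)
  | put (A : ℕ) (i e : Exp) (s : State) :
      Exec W ρ (.put A i e) s
        ⟨s.reg, Function.update s.mem (A, i.eval W ρ s) (e.eval W ρ s)⟩
        ⟨i.size + e.size + 1, i.size + e.size + 1, i.reads W ρ s ∪ e.reads W ρ s,
          {(A, i.eval W ρ s)}⟩
  | seq {c d : Prog} {s t u : State} {p q : Cost} :
      Exec W ρ c s t p → Exec W ρ d t u q → Exec W ρ (.seq c d) s u (p.andThen q)
  | iteTrue {e : Exp} {c d : Prog} {s t : State} {p : Cost} :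
      e.eval W ρ s ≠ 0 → Exec W ρ c s t p →
        Exec W ρ (.ite e c d) s t ((stepCost W ρ s e).andThen p)
  | iteFalse {e : Exp} {c d : Prog} {s t : State} {p : Cost} :
      e.eval W ρ s = 0 → Exec W ρ d s t p →
        Exec W ρ (.ite e c d) s t ((stepCost W ρ s e).andThen p)
  | loopDone {e : Exp} {c : Prog} {s : State} :
      e.eval W ρ s = 0 → Exec W ρ (.loop e c) s s (stepCost W ρ s e)
  | loopStep {e : Exp} {c : Prog} {s t u : State} {p q : Cost} :
      e.eval W ρ s ≠ 0 → Exec W ρ c s t p → Exec W ρ (.loop e c) t u q →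
        Exec W ρ (.loop e c) s u ((stepCost W ρ s e).andThen (p.andThen q))
  | fork {x : ℕ} {e : Exp} {c : Prog} {s : State} (t : ℕ → State) (p : ℕ → Cost)
      (μ : ℕ × ℕ → ℕ) :
      (∀ i < e.eval W ρ s, Exec W ρ c ⟨Function.update s.reg x i, s.mem⟩ (t i) (p i)) →
      RaceFree (e.eval W ρ s) p →
      (∀ i < e.eval W ρ s, ∀ l ∈ (p i).writes, μ l = (t i).mem l) →
      (∀ l, (∀ i < e.eval W ρ s, l ∉ (p i).writes) → μ l = s.mem l) →
        Exec W ρ (.fork x e c) s ⟨s.reg, μ⟩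
          ((stepCost W ρ s e).andThen (Cost.par (e.eval W ρ s) p))

/-- The final state and the cost are determined by the program and the initial state. -/
theorem Exec.det {W : ℕ} {ρ : ℕ → ℕ} {c : Prog} {s t t' : State} {p p' : Cost}
    (h : Exec W ρ c s t p) (h' : Exec W ρ c s t' p') : t = t' ∧ p = p' := by
  induction h generalizing t' p' with
  | skip s => cases h'; exact ⟨rfl, rfl⟩
  | set x e s => cases h'; exact ⟨rfl, rfl⟩
  | put A i e s => cases h'; exact ⟨rfl, rfl⟩
  | seq _ _ ih₁ ih₂ =>
    cases h' with
    | seq a b =>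
      obtain ⟨rfl, rfl⟩ := ih₁ a
      obtain ⟨rfl, rfl⟩ := ih₂ b
      exact ⟨rfl, rfl⟩
  | iteTrue he _ ih =>
    cases h' with
    | iteTrue _ a => obtain ⟨rfl, rfl⟩ := ih a; exact ⟨rfl, rfl⟩
    | iteFalse hn _ => exact absurd hn he
  | iteFalse he _ ih =>
    cases h' with
    | iteTrue hn _ => exact absurd he hn
    | iteFalse _ a => obtain ⟨rfl, rfl⟩ := ih a; exact ⟨rfl, rfl⟩
  | loopDone he =>
    cases h' with
    | loopDone _ => exact ⟨rfl, rfl⟩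
    | loopStep hn _ _ => exact absurd he hn
  | loopStep he _ _ ih₁ ih₂ =>
    cases h' with
    | loopDone hn => exact absurd hn he
    | loopStep _ a b =>
      obtain ⟨rfl, rfl⟩ := ih₁ a
      obtain ⟨rfl, rfl⟩ := ih₂ b
      exact ⟨rfl, rfl⟩
  | @fork x e c s t p μ _ _ hw hn ih =>
    cases h' with
    | fork t₂ p₂ μ₂ hx _ hw₂ hn₂ =>
      have key : ∀ i < e.eval W ρ s, t i = t₂ i ∧ p i = p₂ i := fun i hi => ih i hi (hx i hi)
      have hμ : μ = μ₂ := by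
        funext l
        by_cases hl : ∃ i < e.eval W ρ s, l ∈ (p i).writes
        · obtain ⟨i, hi, hli⟩ := hl
          rw [hw i hi l hli, hw₂ i hi l ((key i hi).2 ▸ hli), (key i hi).1]
        · push Not at hl
          rw [hn l hl, hn₂ l fun i hi => (key i hi).2 ▸ hl i hi]
      have hp : Cost.par (e.eval W ρ s) p = Cost.par (e.eval W ρ s) p₂ := by
        unfold Cost.par
        congr 1
        · exact Finset.sum_congr rfl fun i hi => by rw [(key i (Finset.mem_range.1 hi)).2]
        · exact Finset.sup_congr rfl fun i hi => by rw [(key i (Finset.mem_range.1 hi)).2]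
        · ext l
          exact exists_congr fun i => and_congr_right fun hi => by rw [(key i hi).2]
        · ext l
          exact exists_congr fun i => and_congr_right fun hi => by rw [(key i hi).2]
      rw [hμ, hp]
      exact ⟨rfl, rfl⟩

end ParRAM

/-! ## The two stages and culled balanced partitions -/

namespace CulledPartition

open scoped Classical

variable {V : Type*} [Fintype V]

/-- The number of edges of the induced subgraph `G[S]`. -/
noncomputable def edgesIn (G : SimpleGraph V) (S : Finset V) : ℕ :=
  (G.induce (S : Set V)).edgeSet.ncard

/-- The number of neighbours of `v` in `S`; for `v ∈ S` it is the degree of `v` in `G[S]`. -/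
noncomputable def degIn (G : SimpleGraph V) (S : Finset V) (v : V) : ℕ :=
  {u ∈ S | G.Adj v u}.card

/-- The removal threshold `τ(H) = e(H) / (k⁴ log n)` for `H = G[S]`, where `n` is the number of
vertices of `G` and `log n` is the integer `⌈log₂ n⌉`. -/
noncomputable def threshold (G : SimpleGraph V) (k : ℕ) (S : Finset V) : ℝ :=
  (edgesIn G S : ℝ) / ((k : ℝ) ^ 4 * (Nat.clog 2 (Fintype.card V) : ℝ))

/-- The vertex set on which Stage I ends if it is started with the graph `H = G[S]`: as long as the
maximum degree of `H` exceeds `τ(H)`, remove all vertices of degree greater than `τ(H) / 2`. -/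
noncomputable def survivors (G : SimpleGraph V) (k : ℕ) (S : Finset V) : Finset V :=
  if ∃ v ∈ S, threshold G k S < degIn G S v then
    survivors G k {v ∈ S | (degIn G S v : ℝ) ≤ threshold G k S / 2}
  else S
termination_by S.card
decreasing_by
  rename_i h
  obtain ⟨v, hv, hlt⟩ := h
  refine Finset.card_lt_card (Finset.filter_ssubset.2 ⟨v, hv, ?_⟩)
  have h0 : 0 ≤ threshold G k S := by unfold threshold; positivity
  linarith

/-- The culled set `C` computed by Stage I on `G`. -/
noncomputable def culledSet (G : SimpleGraph V) (k : ℕ) : Finset V :=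
  (survivors G k Finset.univ)ᶜ

/-- Stage II: the `i`-th bucket, if vertex `v` draws the random label `ω v`. -/
noncomputable def bucket (G : SimpleGraph V) (k : ℕ) (ω : V → Fin k) (i : Fin k) : Finset V :=
  {v | v ∉ culledSet G k ∧ ω v = i}

/-- `(C, {V₁, …, V_k})` is a culled balanced partition of `G`, with the explicit bound `s` for the
size of `C` and the explicit constant `D` in the bound `O(m / k²)` for the edges of the pieces. -/
structure IsCulledBalancedPartition (G : SimpleGraph V) {k : ℕ} (C : Finset V)
    (P : Fin k → Finset V) (s D : ℝ) : Prop where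
  card_le : (C.card : ℝ) ≤ s
  disjoint : Pairwise fun i j => Disjoint (P i) (P j)
  cover : Finset.univ.biUnion P = Cᶜ
  balanced : ∀ i, (edgesIn G (P i) : ℝ) ≤ D * (G.edgeSet.ncard : ℝ) / (k : ℝ) ^ 2

/-! ## Input and output of the algorithm -/

/-- `off`, `adj` is an adjacency array of a graph on `0, …, n - 1`: the neighbours of `v` are listed,
without repetition and in any order, in the cells `off v, …, off (v + 1) - 1` of `adj`. -/
structure IsAdjacencyArray {n : ℕ} (G : SimpleGraph (Fin n)) (off adj : ℕ → ℕ) : Prop where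
  off_zero : off 0 = 0
  off_le : ∀ v : Fin n, off v ≤ off (v + 1)
  bijOn : ∀ v : Fin n, Set.BijOn adj (Set.Ico (off v) (off (v + 1))) (Fin.val '' G.neighborSet v)

/-- Registers `0` and `1` hold `n` and `k`, arrays `0` and `1` hold the adjacency array; all other
registers and cells are `0`. -/
def input (n k : ℕ) (off adj : ℕ → ℕ) : ParRAM.State where
  reg x := if x = 0 then n else if x = 1 then k else 0
  mem l := if l.1 = 0 then (if l.2 ≤ n then off l.2 else 0)
    else if l.1 = 1 then (if l.2 < off n then adj l.2 else 0) else 0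

/-- The random tape whose first `n` words are the labels `ω`. -/
def tape {n k : ℕ} (ω : Fin n → Fin k) (j : ℕ) : ℕ :=
  if h : j < n then ω ⟨j, h⟩ else 0

/-- The output encodes a culled set in array `2`, by its indicator function. -/
def outCulled (n : ℕ) (s : ParRAM.State) : Finset (Fin n) :=
  {v | s.mem (2, v) ≠ 0}

/-- The output encodes the pieces in array `3`, by the label of each vertex that is not culled. -/
def outBucket (n k : ℕ) (s : ParRAM.State) (i : Fin k) : Finset (Fin n) :=
  {v | s.mem (2, v) = 0 ∧ s.mem (3, v) = i}

end CulledPartition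

/-! Write `L` for `Nat.clog 2 n`, `e` for the number of edges of the current graph `G[S]`, and `τ =
e / (k⁴ L)`.

Stage I is controlled by halving. If the graph left by a round still has a vertex of degree above
its own threshold `τ'`, that vertex survived the round, so its degree was at most `τ / 2`. Hence `τ'
< τ / 2`, and the edge count more than halves (`two_mul_edgesIn_cull_lt`). So there are `O(log n)`
rounds. In each of them the removed vertices have degree above `e / (2 k⁴ L)` while all degrees add
up to `2 e`, so at most `4 k⁴ L` vertices go (`card_sdiff_cull_le`). Together this bounds `|C|`
deterministically.

For the running time, the program keeps `G[S]` as a list of its `2 e` arcs grouped by source, so a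
round never touches vertices that have become isolated. Degrees are differences of segment ends, and
the surviving arcs are moved together by parallel prefix sums on a binary tree. A round costs `O(e +
1)` work and `O(log n)` depth (`runs_round`). Halving turns the total work into a geometric series,
while the depth is (rounds) × (tree height) (`runs_stageOne_loop`, `exec_algorithm`).

In Stage II a fixed bucket spans `e / k²` edges on average. Changing the label of `v` changes that
number by at most the degree `d v` of `v` in the surviving graph. Stage I stops with all degrees at
most `τ`, so `∑ (d v)² ≤ τ · 2 e = 2 e² / (k⁴ L)`. The bounded differences inequality
(`sum_exp_le_of_boundedDifferences`) then bounds the probability of exceeding the mean by `2 r e /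
k²` by `exp (-r² L)` (`card_unbalanced_le`). As `k` is at most a fixed power of `n`, a large
constant `r` pays for the union bound over the buckets and leaves `n ^ (-γ)`. -/

namespace ParRAM

/-! ### Execution rules with cost bounds, and race-free parallel loops. -/

variable {W : ℕ} {ρ : ℕ → ℕ}

/-- `c` takes the state `s` to the state `t` with work at most `w` and depth at most `d`. -/
def Runs (W : ℕ) (ρ : ℕ → ℕ) (c : Prog) (s t : State) (w d : ℕ) : Prop :=
  ∃ p, Exec W ρ c s t p ∧ p.work ≤ w ∧ p.depth ≤ d

theorem Runs.mono {c : Prog} {s t : State} {w d w' d' : ℕ} (h : Runs W ρ c s t w d)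
    (hw : w ≤ w') (hd : d ≤ d') : Runs W ρ c s t w' d' := by
  obtain ⟨p, h, h1, h2⟩ := h
  exact ⟨p, h, h1.trans hw, h2.trans hd⟩

theorem Runs.seq {c c' : Prog} {s t u : State} {w d w' d' : ℕ} (h : Runs W ρ c s t w d)
    (h' : Runs W ρ c' t u w' d') : Runs W ρ (.seq c c') s u (w + w') (d + d') := by
  obtain ⟨p, h, h1, h2⟩ := h
  obtain ⟨q, h', h3, h4⟩ := h'
  exact ⟨_, .seq h h', Nat.add_le_add h1 h3, Nat.add_le_add h2 h4⟩

theorem Runs.set (x : ℕ) {e : Exp} {s : State} {v : ℕ} (he : e.eval W ρ s = v) :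
    Runs W ρ (.set x e) s ⟨Function.update s.reg x v, s.mem⟩ (e.size + 1) (e.size + 1) := by
  subst he
  exact ⟨_, .set x e s, le_rfl, le_rfl⟩

theorem Runs.put (A : ℕ) {i e : Exp} {s : State} {j v : ℕ} (hi : i.eval W ρ s = j)
    (he : e.eval W ρ s = v) :
    Runs W ρ (.put A i e) s ⟨s.reg, Function.update s.mem (A, j) v⟩ (i.size + e.size + 1)
      (i.size + e.size + 1) := by
  subst he hi
  exact ⟨_, .put A i e s, le_rfl, le_rfl⟩

theorem Runs.iteTrue {e : Exp} {c c' : Prog} {s t : State} {w d : ℕ} (he : e.eval W ρ s ≠ 0)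
    (h : Runs W ρ c s t w d) :
    Runs W ρ (.ite e c c') s t (e.size + 1 + w) (e.size + 1 + d) := by
  obtain ⟨p, h, h1, h2⟩ := h
  exact ⟨_, .iteTrue he h, Nat.add_le_add_left h1 _, Nat.add_le_add_left h2 _⟩

theorem Runs.iteFalse {e : Exp} {c c' : Prog} {s t : State} {w d : ℕ} (he : e.eval W ρ s = 0)
    (h : Runs W ρ c' s t w d) :
    Runs W ρ (.ite e c c') s t (e.size + 1 + w) (e.size + 1 + d) := by
  obtain ⟨p, h, h1, h2⟩ := h
  exact ⟨_, .iteFalse he h, Nat.add_le_add_left h1 _, Nat.add_le_add_left h2 _⟩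

theorem Runs.loopDone {e : Exp} {c : Prog} {s : State} (he : e.eval W ρ s = 0) :
    Runs W ρ (.loop e c) s s (e.size + 1) (e.size + 1) :=
  ⟨_, .loopDone he, le_rfl, le_rfl⟩

theorem Runs.loopStep {e : Exp} {c : Prog} {s t u : State} {w d w' d' : ℕ}
    (he : e.eval W ρ s ≠ 0) (h : Runs W ρ c s t w d) (h' : Runs W ρ (.loop e c) t u w' d') :
    Runs W ρ (.loop e c) s u (e.size + 1 + (w + w')) (e.size + 1 + (d + d')) := by
  obtain ⟨p, h, h1, h2⟩ := h
  obtain ⟨q, h', h3, h4⟩ := h'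
  exact ⟨_, .loopStep he h h', Nat.add_le_add_left (Nat.add_le_add h1 h3) _,
    Nat.add_le_add_left (Nat.add_le_add h2 h4) _⟩

/-- The memory seen at the start by thread `i` of a `fork`. -/
def State.thread (s : State) (x i : ℕ) : State := ⟨Function.update s.reg x i, s.mem⟩

/-- A `fork` whose threads write to pairwise disjoint sets of cells. -/
theorem Exec.exists_fork {x N : ℕ} {e : Exp} {c : Prog} {s : State} (hN : e.eval W ρ s = N)
    (t : ℕ → State) (p : ℕ → Cost) (h : ∀ i < N, Exec W ρ c (s.thread x i) (t i) (p i))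
    (hr : RaceFree N p) :
    ∃ μ, Exec W ρ (.fork x e c) s ⟨s.reg, μ⟩ ((stepCost W ρ s e).andThen (Cost.par N p)) ∧
      (∀ i < N, ∀ l ∈ (p i).writes, μ l = (t i).mem l) ∧
      ∀ l, (∀ i < N, l ∉ (p i).writes) → μ l = s.mem l := by
  classical
  subst hN
  let μ : ℕ × ℕ → ℕ := fun l =>
    if h : ∃ i < e.eval W ρ s, l ∈ (p i).writes then (t h.choose).mem l else s.mem l
  have h1 : ∀ i < e.eval W ρ s, ∀ l ∈ (p i).writes, μ l = (t i).mem l := by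
    intro i hi l hl
    have hex : ∃ i < e.eval W ρ s, l ∈ (p i).writes := ⟨i, hi, hl⟩
    have : hex.choose = i := by
      by_contra hne
      exact Set.disjoint_left.1 (hr _ hex.choose_spec.1 i hi hne) hex.choose_spec.2 (.inr hl)
    simp only [μ, dif_pos hex, this]
  have h2 : ∀ l, (∀ i < e.eval W ρ s, l ∉ (p i).writes) → μ l = s.mem l := by
    intro l hl
    exact dif_neg fun ⟨i, hi, hli⟩ => hl i hi hli
  exact ⟨μ, .fork t p μ h hr h1 h2, h1, h2⟩

theorem Cost.par_work_le {N w : ℕ} {p : ℕ → Cost} (h : ∀ i < N, (p i).work ≤ w) :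
    (Cost.par N p).work ≤ N * (w + 1) := by
  refine (Finset.sum_le_card_nsmul (Finset.range N) (fun i => (p i).work + 1) (w + 1)
    fun i hi => ?_).trans (by simp)
  exact Nat.succ_le_succ (h i (Finset.mem_range.1 hi))

theorem Cost.par_depth_le {N d : ℕ} {p : ℕ → Cost} (h : ∀ i < N, (p i).depth ≤ d) :
    (Cost.par N p).depth ≤ d + 1 :=
  Finset.sup_le fun i hi => Nat.succ_le_succ (h i (Finset.mem_range.1 hi))

/-- In parallel for all `x < N`: if `b` then `A[idx] := e`. -/
def scatter (x : ℕ) (N b : Exp) (A : ℕ) (idx e : Exp) : Prog :=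
  .fork x N (.ite b (.put A idx e) .skip)

/-- Injectivity of the target index excludes write-write races, and `hr` excludes read-write races.
The cells read and written are exposed because a scatter may itself run inside a thread of another
fork, where they decide the outer race-freedom. -/
theorem Exec.exists_scatter {x N A : ℕ} {eN b idx e : Exp} {s : State}
    (hN : eN.eval W ρ s = N) (P : ℕ → Prop) (f g : ℕ → ℕ)
    (hb : ∀ i < N, b.eval W ρ (s.thread x i) ≠ 0 ↔ P i)
    (hf : ∀ i < N, P i → idx.eval W ρ (s.thread x i) = f i)
    (hg : ∀ i < N, P i → e.eval W ρ (s.thread x i) = g i)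
    (hinj : ∀ i < N, ∀ j < N, P i → P j → f i = f j → i = j)
    (hr : ∀ i < N, ∀ j < N, i ≠ j → P i → (A, f i) ∉ b.reads W ρ (s.thread x j) ∪
      (idx.reads W ρ (s.thread x j) ∪ e.reads W ρ (s.thread x j))) :
    ∃ μ p, Exec W ρ (scatter x eN b A idx e) s ⟨s.reg, μ⟩ p ∧
      p.work ≤ eN.size + 1 + N * (b.size + idx.size + e.size + 3) ∧
      p.depth ≤ eN.size + 1 + (b.size + idx.size + e.size + 3) ∧
      (p.reads ⊆ eN.reads W ρ s ∪ {l | ∃ j < N, l ∈ b.reads W ρ (s.thread x j) ∪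
        (idx.reads W ρ (s.thread x j) ∪ e.reads W ρ (s.thread x j))}) ∧
      (∀ l, l ∈ p.writes ↔ ∃ i < N, P i ∧ l = (A, f i)) ∧
      (∀ i < N, P i → μ (A, f i) = g i) ∧
      ∀ l, (∀ i < N, P i → l ≠ (A, f i)) → μ l = s.mem l := by
  classical
  have key : ∀ i, ∃ t p, i < N → Exec W ρ (.ite b (.put A idx e) .skip) (s.thread x i) t p ∧
      p.work ≤ b.size + idx.size + e.size + 2 ∧ p.depth ≤ b.size + idx.size + e.size + 2 ∧
      (p.reads ⊆ b.reads W ρ (s.thread x i) ∪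
        (idx.reads W ρ (s.thread x i) ∪ e.reads W ρ (s.thread x i))) ∧
      (∀ l, l ∈ p.writes ↔ P i ∧ l = (A, f i)) ∧ (P i → t.mem (A, f i) = g i) := by
    intro i
    by_cases hi : i < N
    · by_cases hP : P i
      · refine ⟨_, _, fun _ => ⟨.iteTrue ((hb i hi).2 hP) (.put ..), ?_⟩⟩
        simp only [Cost.andThen, stepCost, hf i hi hP, hg i hi hP]
        refine ⟨by omega, by omega, le_rfl, fun l => by simp [hP], fun _ => by simp⟩
      · have h0 : b.eval W ρ (s.thread x i) = 0 := by
          by_contra h; exact hP ((hb i hi).1 h)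
        refine ⟨_, _, fun _ => ⟨.iteFalse h0 (.skip _), ?_⟩⟩
        simp only [Cost.andThen, stepCost]
        have : 1 ≤ e.size := by cases e <;> simp [Exp.size]
        refine ⟨by omega, by omega, by simp, fun l => by simp [hP], fun h => absurd h hP⟩
    · exact ⟨s, ⟨0, 0, ∅, ∅⟩, fun h => absurd h hi⟩
  choose t p h using key
  have hrace : RaceFree N p := by
    intro i hi j hj hij
    refine Set.disjoint_left.2 fun l hl hl' => ?_
    obtain ⟨hP, rfl⟩ := ((h i hi).2.2.2.2.1 l).1 hl
    rcases hl' with hl' | hl'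
    · exact hr i hi j hj hij hP ((h j hj).2.2.2.1 hl')
    · obtain ⟨hPj, he⟩ := ((h j hj).2.2.2.2.1 _).1 hl'
      exact hij (hinj i hi j hj hP hPj (Prod.ext_iff.1 he).2)
  obtain ⟨μ, hex, h1, h2⟩ := Exec.exists_fork hN t p (fun i hi => (h i hi).1) hrace
  refine ⟨μ, _, hex, ?_, ?_, ?_, ?_, ?_, ?_⟩
  · exact Nat.add_le_add_left (Cost.par_work_le fun i hi => (h i hi).2.1) _
  · exact Nat.add_le_add_left (Cost.par_depth_le fun i hi => (h i hi).2.2.1) _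
  · refine Set.union_subset_union le_rfl ?_
    rintro l ⟨i, hi, hl⟩
    exact ⟨i, hi, (h i hi).2.2.2.1 hl⟩
  · intro l
    constructor
    · rintro (hl | ⟨i, hi, hl⟩)
      · exact absurd hl (by simp [stepCost])
      · exact ⟨i, hi, ((h i hi).2.2.2.2.1 l).1 hl⟩
    · rintro ⟨i, hi, hl⟩
      exact .inr ⟨i, hi, ((h i hi).2.2.2.2.1 l).2 hl⟩
  · intro i hi hP
    rw [h1 i hi _ (((h i hi).2.2.2.2.1 _).2 ⟨hP, rfl⟩), (h i hi).2.2.2.2.2 hP]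
  · intro l hl
    exact h2 l fun i hi hli => by
      obtain ⟨hP, he⟩ := ((h i hi).2.2.2.2.1 l).1 hli
      exact hl i hi hP he

theorem Runs.exists_scatter {x N A : ℕ} {eN b idx e : Exp} {s : State}
    (hN : eN.eval W ρ s = N) (P : ℕ → Prop) (f g : ℕ → ℕ)
    (hb : ∀ i < N, b.eval W ρ (s.thread x i) ≠ 0 ↔ P i)
    (hf : ∀ i < N, P i → idx.eval W ρ (s.thread x i) = f i)
    (hg : ∀ i < N, P i → e.eval W ρ (s.thread x i) = g i)
    (hinj : ∀ i < N, ∀ j < N, P i → P j → f i = f j → i = j)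
    (hr : ∀ i < N, ∀ j < N, i ≠ j → P i → (A, f i) ∉ b.reads W ρ (s.thread x j) ∪
      (idx.reads W ρ (s.thread x j) ∪ e.reads W ρ (s.thread x j))) :
    ∃ μ, Runs W ρ (scatter x eN b A idx e) s ⟨s.reg, μ⟩
      (eN.size + 1 + N * (b.size + idx.size + e.size + 3))
      (eN.size + 1 + (b.size + idx.size + e.size + 3)) ∧
      (∀ i < N, P i → μ (A, f i) = g i) ∧
      ∀ l, (∀ i < N, P i → l ≠ (A, f i)) → μ l = s.mem l := by
  obtain ⟨μ, p, h, hw, hd, -, -, h1, h2⟩ := Exec.exists_scatter hN P f g hb hf hg hinj hr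
  exact ⟨μ, ⟨p, h, hw, hd⟩, h1, h2⟩

/-- The arrays occurring in an expression. -/
def Exp.arrays : Exp → List ℕ
  | .lit _ => []
  | .reg _ => []
  | .op _ e f => e.arrays ++ f.arrays
  | .get A e => A :: e.arrays
  | .rand e => e.arrays

/-- This reduces race-freedom between different arrays to a syntactic check. -/
theorem Exp.fst_mem_arrays {s : State} {l : ℕ × ℕ} {e : Exp} (h : l ∈ e.reads W ρ s) :
    l.1 ∈ e.arrays := by
  induction e with
  | lit | reg => exact absurd h (by simp [Exp.reads])
  | op o e f ihe ihf =>
    simp only [Exp.arrays, List.mem_append]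
    exact h.imp ihe ihf
  | get A e ih =>
    rcases h with rfl | h
    · simp [Exp.arrays]
    · exact List.mem_cons_of_mem _ (ih h)
  | rand e ih => exact ih h

/-- A parallel loop that does not read the array to which it writes. -/
theorem Runs.exists_scatter_of_notMem {x N A : ℕ} {eN b idx e : Exp} {s : State}
    (hN : eN.eval W ρ s = N) (P : ℕ → Prop) (f g : ℕ → ℕ)
    (hA : A ∉ b.arrays ++ (idx.arrays ++ e.arrays))
    (hb : ∀ i < N, b.eval W ρ (s.thread x i) ≠ 0 ↔ P i)
    (hf : ∀ i < N, P i → idx.eval W ρ (s.thread x i) = f i)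
    (hg : ∀ i < N, P i → e.eval W ρ (s.thread x i) = g i)
    (hinj : ∀ i < N, ∀ j < N, P i → P j → f i = f j → i = j) :
    ∃ μ, Runs W ρ (scatter x eN b A idx e) s ⟨s.reg, μ⟩
      (eN.size + 1 + N * (b.size + idx.size + e.size + 3))
      (eN.size + 1 + (b.size + idx.size + e.size + 3)) ∧
      (∀ i < N, P i → μ (A, f i) = g i) ∧
      ∀ l, (∀ i < N, P i → l ≠ (A, f i)) → μ l = s.mem l := by
  refine Runs.exists_scatter hN P f g hb hf hg hinj fun i _ j _ _ _ h => hA ?_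
  rw [List.mem_append, List.mem_append]
  rcases h with h | h | h
  · exact .inl (Exp.fst_mem_arrays h)
  · exact .inr (.inl (Exp.fst_mem_arrays h))
  · exact .inr (.inr (Exp.fst_mem_arrays h))

end ParRAM

/-! ### Parallel prefix sums on a binary tree. -/

namespace ParRAM

variable {W : ℕ} {ρ : ℕ → ℕ}

/-- The sum of `a` over the `x`-th block of length `2 ^ e`. -/
def blockSum (a : ℕ → ℕ) (e x : ℕ) : ℕ := ∑ y ∈ Finset.range (2 ^ e), a (x * 2 ^ e + y)

/-- The sum of `a` over the first `x` blocks of length `2 ^ e`. -/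
def prefixSum (a : ℕ → ℕ) (e x : ℕ) : ℕ := ∑ y ∈ Finset.range (x * 2 ^ e), a y

theorem prefixSum_succ (a : ℕ → ℕ) (e x : ℕ) :
    prefixSum a e (x + 1) = prefixSum a e x + blockSum a e x := by
  simp only [prefixSum, blockSum, Nat.succ_mul, Finset.sum_range_add]

theorem prefixSum_level_succ (a : ℕ → ℕ) (e x : ℕ) :
    prefixSum a (e + 1) x = prefixSum a e (2 * x) := by
  simp only [prefixSum]
  congr 2
  ring

/-- Blocks are differences of prefix sums, and doubling the block length only reindexes the prefix
sums, so the identity telescopes. -/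
theorem blockSum_succ (a : ℕ → ℕ) (e x : ℕ) :
    blockSum a (e + 1) x = blockSum a e (2 * x) + blockSum a e (2 * x + 1) := by
  have h1 := prefixSum_succ a (e + 1) x
  have h2 := prefixSum_succ a e (2 * x)
  have h3 := prefixSum_succ a e (2 * x + 1)
  rw [prefixSum_level_succ, prefixSum_level_succ, show 2 * (x + 1) = 2 * x + 1 + 1 by ring] at h1
  omega

theorem prefixSum_mono (a : ℕ → ℕ) (e : ℕ) {x y : ℕ} (h : x ≤ y) :
    prefixSum a e x ≤ prefixSum a e y :=
  Finset.sum_le_sum_of_subset (Finset.range_mono (Nat.mul_le_mul_right _ h))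

theorem prefixSum_pow (a : ℕ → ℕ) {e h : ℕ} (he : e ≤ h) :
    prefixSum a (h - e) (2 ^ e) = ∑ y ∈ Finset.range (2 ^ h), a y := by
  rw [prefixSum, ← pow_add, Nat.add_sub_cancel' he]

theorem prefixSum_le (a : ℕ → ℕ) {e h x : ℕ} (he : e ≤ h) (hx : x ≤ 2 ^ e) :
    prefixSum a (h - e) x ≤ ∑ y ∈ Finset.range (2 ^ h), a y :=
  (prefixSum_mono _ _ hx).trans (prefixSum_pow a he).le

theorem blockSum_le (a : ℕ → ℕ) {e h x : ℕ} (he : e ≤ h) (hx : x < 2 ^ e) :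
    blockSum a (h - e) x ≤ ∑ y ∈ Finset.range (2 ^ h), a y := by
  have h1 := prefixSum_succ a (h - e) x
  have h2 := prefixSum_le a he (x := x + 1) hx
  omega

/-- One level of the upward pass. -/
def upsweepStep : Prog :=
  .seq (.set 7 (.op .div (.reg 7) (.lit 2)))
    (scatter 8 (.reg 7) (.lit 1) 7 (.op .add (.reg 7) (.reg 8))
      (.op .add (.get 7 (.op .mul (.lit 2) (.op .add (.reg 7) (.reg 8))))
        (.get 7 (.op .add (.op .mul (.lit 2) (.op .add (.reg 7) (.reg 8))) (.lit 1)))))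

/-- Array `7` holds a binary tree with `q` leaves in the cells `q, …, 2 q - 1`; every inner node
receives the sum of the leaves below it. -/
def upsweep : Prog :=
  .seq (.set 7 (.reg 5)) (.loop (.op .lt (.lit 1) (.reg 7)) upsweepStep)

/-- The tree is stored in heap order: the children of cell `y` are `2 y` and `2 y + 1`. The step
reads level `e + 1` and writes level `e` of the same array; these ranges of cells are disjoint, so
the threads do not race. -/
theorem runs_upsweepStep {s : State} {a : ℕ → ℕ} {h e : ℕ} (he : e < h)
    (hp : s.reg 7 = 2 ^ (e + 1)) (hW : 2 ^ (h + 1) < W)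
    (hsum : ∑ x ∈ Finset.range (2 ^ h), a x < W)
    (ha : ∀ f, e < f → f ≤ h → ∀ x < 2 ^ f, s.mem (7, 2 ^ f + x) = blockSum a (h - f) x) :
    ∃ μ, Runs W ρ upsweepStep s ⟨Function.update s.reg 7 (2 ^ e), μ⟩
        (22 * 2 ^ e + 6) 28 ∧
      (∀ l, l.1 ≠ 7 → μ l = s.mem l) ∧
      ∀ f, e ≤ f → f ≤ h → ∀ x < 2 ^ f, μ (7, 2 ^ f + x) = blockSum a (h - f) x := by
  have hle : 2 ^ e * 2 ≤ 2 ^ h := (pow_succ 2 e).symm.le.trans (Nat.pow_le_pow_right (by simp) he)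
  have hpos : 0 < 2 ^ e := by positivity
  rw [pow_succ] at hW hp
  have hset := Runs.set (W := W) (ρ := ρ) 7 (e := .op .div (.reg 7) (.lit 2)) (s := s) (v := 2 ^ e)
    (by simp [Exp.eval, Op.apply, hp, Nat.mod_eq_of_lt (show 2 < W by omega)])
  set s' : State := ⟨Function.update s.reg 7 (2 ^ e), s.mem⟩ with hs'
  have e1 : ∀ i < 2 ^ e, (2 ^ e + i) % W = 2 ^ e + i := fun i hi => Nat.mod_eq_of_lt (by omega)
  have e2 : ∀ i < 2 ^ e, (2 * (2 ^ e + i)) % W = 2 * (2 ^ e + i) :=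
    fun i hi => Nat.mod_eq_of_lt (by omega)
  have e3 : ∀ i < 2 ^ e, (2 * (2 ^ e + i) + 1) % W = 2 * (2 ^ e + i) + 1 :=
    fun i hi => Nat.mod_eq_of_lt (by omega)
  have c1 : 1 % W = 1 := Nat.mod_eq_of_lt (by omega)
  have c2 : 2 % W = 2 := Nat.mod_eq_of_lt (by omega)
  obtain ⟨μ, hrun, h1, h2⟩ := Runs.exists_scatter (W := W) (ρ := ρ) (x := 8) (A := 7) (s := s')
    (N := 2 ^ e) (eN := .reg 7) (b := .lit 1) (idx := .op .add (.reg 7) (.reg 8))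
    (e := .op .add (.get 7 (.op .mul (.lit 2) (.op .add (.reg 7) (.reg 8))))
        (.get 7 (.op .add (.op .mul (.lit 2) (.op .add (.reg 7) (.reg 8))) (.lit 1))))
    (by simp [Exp.eval, s']) (fun _ => True) (fun i => 2 ^ e + i) (fun i => blockSum a (h - e) i)
    (fun i hi => by simp [Exp.eval, c1])
    (fun i hi _ => by simp [Exp.eval, Op.apply, s', State.thread, e1 i hi])
    (fun i hi _ => by
      have hb := blockSum_le a he.le hi
      have hb' : blockSum a (h - e) i
          = blockSum a (h - (e + 1)) (2 * i) + blockSum a (h - (e + 1)) (2 * i + 1) := by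
        rw [← blockSum_succ]
        congr 1
        omega
      have m1 := ha (e + 1) (by omega) he (2 * i) (by rw [pow_succ]; omega)
      have m2 := ha (e + 1) (by omega) he (2 * i + 1) (by rw [pow_succ]; omega)
      rw [pow_succ, show 2 ^ e * 2 + 2 * i = 2 * (2 ^ e + i) by ring] at m1
      rw [pow_succ, show 2 ^ e * 2 + (2 * i + 1) = 2 * (2 ^ e + i) + 1 by ring] at m2
      simp only [Exp.eval, Op.apply, s', State.thread, Function.update_self, ne_eq,
        Nat.reduceEqDiff, not_false_eq_true, Function.update_of_ne, e1 i hi, c2, e2 i hi, c1,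
        e3 i hi, m1, m2]
      rw [hb']
      exact Nat.mod_eq_of_lt (by omega))
    (fun i _ j _ _ _ hij => by simpa using hij)
    (fun i hi j hj hij _ => by
      simp [Exp.eval, Exp.reads, Op.apply, s', State.thread, e1 j hj, c2, e2 j hj, c1, e3 j hj]
      omega)
  refine ⟨μ, (hset.seq hrun).mono ?_ ?_, ?_, ?_⟩
  · simp only [Exp.size]
    omega
  · simp only [Exp.size]
    omega
  · intro l hl
    exact h2 l fun i _ _ hli => hl (by rw [hli])
  · intro f hf hfh x hx
    rcases hf.eq_or_lt with rfl | hf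
    · exact h1 x hx trivial
    · rw [h2, ← ha f hf hfh x hx]
      intro i hi _ heq
      have : 2 ^ (e + 1) ≤ 2 ^ f := Nat.pow_le_pow_right (by simp) hf
      rw [pow_succ] at this
      have := (Prod.ext_iff.1 heq).2
      simp only at this
      omega

theorem runs_upsweep_loop {a : ℕ → ℕ} {h : ℕ} (hW : 2 ^ (h + 1) < W)
    (hsum : ∑ x ∈ Finset.range (2 ^ h), a x < W) (e : ℕ) (he : e ≤ h) (s : State)
    (hp : s.reg 7 = 2 ^ e)
    (ha : ∀ f, e ≤ f → f ≤ h → ∀ x < 2 ^ f, s.mem (7, 2 ^ f + x) = blockSum a (h - f) x) :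
    ∃ t, Runs W ρ (.loop (.op .lt (.lit 1) (.reg 7)) upsweepStep) s t
        (34 * 2 ^ e) (34 * (e + 1)) ∧
      (∀ x, x ≠ 7 → t.reg x = s.reg x) ∧ (∀ l, l.1 ≠ 7 → t.mem l = s.mem l) ∧
      ∀ f, f ≤ h → ∀ x < 2 ^ f, t.mem (7, 2 ^ f + x) = blockSum a (h - f) x := by
  have hpos : 0 < 2 ^ h := by positivity
  have hW' := hW
  rw [pow_succ] at hW'
  have c1 : 1 % W = 1 := Nat.mod_eq_of_lt (by omega)
  induction e generalizing s with
  | zero =>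
    refine ⟨s, (Runs.loopDone ?_).mono ?_ ?_, fun _ _ => rfl, fun _ _ => rfl,
      fun f hf x hx => ha f (by omega) hf x hx⟩
    · simp [Exp.eval, Op.apply, hp, c1]
    · simp [Exp.size]
    · simp [Exp.size]
  | succ e ih =>
    obtain ⟨μ, hrun, h1, h2⟩ := runs_upsweepStep (ρ := ρ) (by omega) hp hW hsum
      (fun f hf => ha f hf)
    obtain ⟨t, hrun', h3, h4, h5⟩ := ih (by omega) ⟨Function.update s.reg 7 (2 ^ e), μ⟩
      (by simp) (fun f hf => h2 f hf)
    have hpe : 0 < 2 ^ e := by positivity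
    refine ⟨t, (Runs.loopStep ?_ hrun hrun').mono ?_ ?_, ?_, ?_, h5⟩
    · simp [Exp.eval, Op.apply, hp, c1]
    -- The work is a geometric series over the levels: the bound doubles with `e`, which covers the
    -- cost of the extra level.
    · simp only [Exp.size, pow_succ]
      omega
    · simp only [Exp.size]
      omega
    · intro x hx
      rw [h3 x hx]
      exact Function.update_of_ne hx ..
    · intro l hl
      rw [h4 l hl]
      exact h1 l hl

theorem runs_upsweep {a : ℕ → ℕ} {h : ℕ} (hW : 2 ^ (h + 1) < W)
    (hsum : ∑ x ∈ Finset.range (2 ^ h), a x < W) (s : State) (hq : s.reg 5 = 2 ^ h)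
    (ha : ∀ x < 2 ^ h, s.mem (7, 2 ^ h + x) = a x) :
    ∃ t, Runs W ρ upsweep s t (36 * 2 ^ h) (36 * (h + 1)) ∧
      (∀ x, x ≠ 7 → t.reg x = s.reg x) ∧ (∀ l, l.1 ≠ 7 → t.mem l = s.mem l) ∧
      ∀ f, f ≤ h → ∀ x < 2 ^ f, t.mem (7, 2 ^ f + x) = blockSum a (h - f) x := by
  have hset := Runs.set (W := W) (ρ := ρ) 7 (e := .reg 5) (s := s) hq
  obtain ⟨t, hrun, h1, h2, h3⟩ := runs_upsweep_loop (ρ := ρ) hW hsum h le_rfl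
    ⟨Function.update s.reg 7 (2 ^ h), s.mem⟩ (by simp) (by
      intro f hf hf' x hx
      obtain rfl : f = h := le_antisymm hf' hf
      simp [ha x hx, blockSum])
  have hpe : 0 < 2 ^ h := by positivity
  refine ⟨t, (hset.seq hrun).mono ?_ ?_, ?_, h2, h3⟩
  · simp only [Exp.size]
    omega
  · simp only [Exp.size]
    omega
  · intro x hx
    rw [h1 x hx]
    exact Function.update_of_ne hx ..

/-- One level of the downward pass. -/
def downsweepStep : Prog :=
  .seq (.set 7 (.op .add (.reg 7) (.reg 7)))
    (scatter 8 (.reg 7) (.lit 1) 8 (.op .add (.reg 7) (.reg 8))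
      (.op .add (.get 8 (.op .div (.op .add (.reg 7) (.reg 8)) (.lit 2)))
        (.op .mul
          (.op .sub (.op .add (.reg 7) (.reg 8))
            (.op .mul (.lit 2) (.op .div (.op .add (.reg 7) (.reg 8)) (.lit 2))))
          (.get 7 (.op .sub (.op .add (.reg 7) (.reg 8)) (.lit 1))))))

/-- Array `8` receives, at every node of the tree in array `7`, the sum of the leaves to the left of
the subtree of the node. -/
def downsweep : Prog :=
  .seq (.put 8 (.lit 1) (.lit 0))
    (.seq (.set 7 (.lit 1)) (.loop (.op .lt (.reg 7) (.reg 5)) downsweepStep))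

/-- A left child inherits the prefix sum of its parent; a right child adds the block sum of its left
sibling. The case distinction is made by multiplying with the parity of the cell number, so for left
children the value read from the preceding cell does not matter. -/
theorem runs_downsweepStep {s : State} {a : ℕ → ℕ} {h e : ℕ} (he : e < h)
    (hp : s.reg 7 = 2 ^ e) (hW : 2 ^ (h + 1) < W)
    (hsum : ∑ x ∈ Finset.range (2 ^ h), a x < W)
    (ha : ∀ x < 2 ^ (e + 1), s.mem (7, 2 ^ (e + 1) + x) = blockSum a (h - (e + 1)) x)
    (hs : ∀ x < 2 ^ e, s.mem (8, 2 ^ e + x) = prefixSum a (h - e) x) :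
    ∃ μ, Runs W ρ downsweepStep s ⟨Function.update s.reg 7 (2 ^ (e + 1)), μ⟩
        (32 * 2 ^ (e + 1) + 6) 38 ∧
      (∀ l, l.1 ≠ 8 → μ l = s.mem l) ∧
      ∀ x < 2 ^ (e + 1), μ (8, 2 ^ (e + 1) + x) = prefixSum a (h - (e + 1)) x := by
  have hle : 2 ^ (e + 1) ≤ 2 ^ h := Nat.pow_le_pow_right (by simp) he
  have hpos : 0 < 2 ^ e := by positivity
  rw [pow_succ] at hW
  have hpe : 2 ^ (e + 1) = 2 ^ e + 2 ^ e := by rw [pow_succ]; ring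
  have hset := Runs.set (W := W) (ρ := ρ) 7 (e := .op .add (.reg 7) (.reg 7)) (s := s)
    (v := 2 ^ (e + 1))
    (by simp [Exp.eval, Op.apply, hp, ← hpe, Nat.mod_eq_of_lt (show 2 ^ (e + 1) < W by omega)])
  set s' : State := ⟨Function.update s.reg 7 (2 ^ (e + 1)), s.mem⟩ with hs'
  have c1 : 1 % W = 1 := Nat.mod_eq_of_lt (by omega)
  have c2 : 2 % W = 2 := Nat.mod_eq_of_lt (by omega)
  have e1 : ∀ i < 2 ^ (e + 1), (2 ^ (e + 1) + i) % W = 2 ^ (e + 1) + i :=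
    fun i hi => Nat.mod_eq_of_lt (by omega)
  have e2 : ∀ i < 2 ^ (e + 1), (2 ^ (e + 1) + i) / 2 = 2 ^ e + i / 2 := fun i hi => by omega
  have e3 : ∀ i < 2 ^ (e + 1), (2 * (2 ^ e + i / 2)) % W = 2 * (2 ^ e + i / 2) :=
    fun i hi => Nat.mod_eq_of_lt (by omega)
  have e4 : ∀ i, 2 ^ (e + 1) + i - 2 * (2 ^ e + i / 2) = i % 2 := fun i => by omega
  obtain ⟨μ, hrun, h1, h2⟩ := Runs.exists_scatter (W := W) (ρ := ρ) (x := 8) (A := 8) (s := s')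
    (N := 2 ^ (e + 1)) (eN := .reg 7) (b := .lit 1) (idx := .op .add (.reg 7) (.reg 8))
    (e := .op .add (.get 8 (.op .div (.op .add (.reg 7) (.reg 8)) (.lit 2)))
        (.op .mul
          (.op .sub (.op .add (.reg 7) (.reg 8))
            (.op .mul (.lit 2) (.op .div (.op .add (.reg 7) (.reg 8)) (.lit 2))))
          (.get 7 (.op .sub (.op .add (.reg 7) (.reg 8)) (.lit 1)))))
    (by simp [Exp.eval, s']) (fun _ => True) (fun i => 2 ^ (e + 1) + i)
    (fun i => prefixSum a (h - (e + 1)) i)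
    (fun i hi => by simp [Exp.eval, c1])
    (fun i hi _ => by simp [Exp.eval, Op.apply, s', State.thread, e1 i hi])
    (fun i hi _ => by
      have hb := prefixSum_le a (show e + 1 ≤ h from he) hi.le
      have hm := hs (i / 2) (by omega)
      rw [show h - e = h - (e + 1) + 1 by omega, prefixSum_level_succ] at hm
      simp only [Exp.eval, Op.apply, s', State.thread, Function.update_self, ne_eq,
        Nat.reduceEqDiff, not_false_eq_true, Function.update_of_ne, e1 i hi, c2, e2 i hi, c1,
        e3 i hi, e4, hm]
      rcases Nat.mod_two_eq_zero_or_one i with h0 | h0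
      · rw [h0, show 2 * (i / 2) = i by omega, zero_mul, Nat.zero_mod, add_zero]
        exact Nat.mod_eq_of_lt (by omega)
      · obtain ⟨j, rfl⟩ : ∃ j, i = j + 1 := ⟨i - 1, by omega⟩
        rw [h0, one_mul, show 2 ^ (e + 1) + (j + 1) - 1 = 2 ^ (e + 1) + j by omega,
          ha j (by omega), show 2 * ((j + 1) / 2) = j by omega]
        rw [prefixSum_succ] at hb ⊢
        rw [Nat.mod_eq_of_lt (a := blockSum _ _ _) (by omega)]
        exact Nat.mod_eq_of_lt (by omega))
    (fun i _ j _ _ _ hij => by simpa using hij)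
    (fun i hi j hj hij _ => by
      simp [Exp.eval, Exp.reads, Op.apply, s', State.thread, e1 j hj, c2, e2 j hj, c1]
      omega)
  refine ⟨μ, (hset.seq hrun).mono ?_ ?_, ?_, ?_⟩
  · simp only [Exp.size]
    omega
  · simp only [Exp.size]
    omega
  · intro l hl
    exact h2 l fun i _ _ hli => hl (by rw [hli])
  · intro x hx
    exact h1 x hx trivial

theorem runs_downsweep_loop {a : ℕ → ℕ} {h : ℕ} (hW : 2 ^ (h + 1) < W)
    (hsum : ∑ x ∈ Finset.range (2 ^ h), a x < W) (i e : ℕ) (he : e + i = h) (s : State)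
    (hq : s.reg 5 = 2 ^ h) (hp : s.reg 7 = 2 ^ e)
    (ha : ∀ f ≤ h, ∀ x < 2 ^ f, s.mem (7, 2 ^ f + x) = blockSum a (h - f) x)
    (hs : ∀ x < 2 ^ e, s.mem (8, 2 ^ e + x) = prefixSum a (h - e) x) :
    ∃ t, Runs W ρ (.loop (.op .lt (.reg 7) (.reg 5)) downsweepStep) s t
        -- The levels still to be written have `2 * 2 ^ h - 2 * 2 ^ e` nodes in total; the extra `2
        -- ^ e` pays for the constants.
        (75 * (2 * 2 ^ h - 2 ^ e)) (45 * (i + 1)) ∧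
      (∀ x, x ≠ 7 → t.reg x = s.reg x) ∧ (∀ l, l.1 ≠ 8 → t.mem l = s.mem l) ∧
      ∀ x < 2 ^ h, t.mem (8, 2 ^ h + x) = ∑ y ∈ Finset.range x, a y := by
  have hpos : 0 < 2 ^ h := by positivity
  induction i generalizing e s with
  | zero =>
    obtain rfl : e = h := he
    refine ⟨s, (Runs.loopDone ?_).mono ?_ ?_, fun _ _ => rfl, fun _ _ => rfl,
      fun x hx => by simpa [prefixSum] using hs x hx⟩
    · simp [Exp.eval, Op.apply, hp, hq]
    · simp only [Exp.size]
      omega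
    · simp [Exp.size]
  | succ i ih =>
    obtain ⟨μ, hrun, h1, h2⟩ := runs_downsweepStep (ρ := ρ) (by omega) hp hW hsum
      (ha (e + 1) (by omega)) hs
    obtain ⟨t, hrun', h3, h4, h5⟩ := ih (e + 1) (by omega)
      ⟨Function.update s.reg 7 (2 ^ (e + 1)), μ⟩ (by simpa using hq) (by simp)
      (fun f hf x hx => by rw [← ha f hf x hx]; exact h1 _ (by simp)) h2
    have hpe : 0 < 2 ^ e := by positivity
    have hle : 2 ^ (e + 1) ≤ 2 ^ h := Nat.pow_le_pow_right (by simp) (by omega)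
    refine ⟨t, (Runs.loopStep ?_ hrun hrun').mono ?_ ?_, ?_, ?_, h5⟩
    · rw [pow_succ] at hle
      simp only [Exp.eval, Op.apply, hp, hq]
      rw [if_pos (by omega)]
      simp
    · simp only [Exp.size, pow_succ] at hle ⊢
      omega
    · simp only [Exp.size]
      omega
    · intro x hx
      rw [h3 x hx]
      exact Function.update_of_ne hx ..
    · intro l hl
      rw [h4 l hl]
      exact h1 l hl

theorem runs_downsweep {a : ℕ → ℕ} {h : ℕ} (hW : 2 ^ (h + 1) < W)
    (hsum : ∑ x ∈ Finset.range (2 ^ h), a x < W) (s : State) (hq : s.reg 5 = 2 ^ h)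
    (ha : ∀ f ≤ h, ∀ x < 2 ^ f, s.mem (7, 2 ^ f + x) = blockSum a (h - f) x) :
    ∃ t, Runs W ρ downsweep s t (155 * 2 ^ h) (50 * (h + 1)) ∧
      (∀ x, x ≠ 7 → t.reg x = s.reg x) ∧ (∀ l, l.1 ≠ 8 → t.mem l = s.mem l) ∧
      ∀ x < 2 ^ h, t.mem (8, 2 ^ h + x) = ∑ y ∈ Finset.range x, a y := by
  have hpos : 0 < 2 ^ h := by positivity
  have hW' := hW
  rw [pow_succ] at hW'
  have c1 : 1 % W = 1 := Nat.mod_eq_of_lt (by omega)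
  have hput := Runs.put (W := W) (ρ := ρ) 8 (i := .lit 1) (e := .lit 0) (s := s) (j := 1) (v := 0)
    (by simp [Exp.eval, c1]) (by simp [Exp.eval])
  have hset := Runs.set (W := W) (ρ := ρ) 7 (e := .lit 1)
    (s := ⟨s.reg, Function.update s.mem (8, 1) 0⟩) (v := 1) (by simp [Exp.eval, c1])
  obtain ⟨t, hrun, h1, h2, h3⟩ := runs_downsweep_loop (ρ := ρ) hW hsum h 0 (by simp)
    ⟨Function.update s.reg 7 1, Function.update s.mem (8, 1) 0⟩ (by simpa using hq) (by simp)
    (fun f hf x hx => by simpa using ha f hf x hx)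
    (fun x hx => by
      obtain rfl : x = 0 := by simpa using hx
      simp [prefixSum])
  refine ⟨t, (hput.seq (hset.seq hrun)).mono ?_ ?_, ?_, ?_, h3⟩
  · simp only [Exp.size]
    omega
  · simp only [Exp.size]
    omega
  · intro x hx
    rw [h1 x hx]
    exact Function.update_of_ne hx ..
  · intro l hl
    rw [h2 l hl]
    exact Function.update_of_ne (fun h => hl (by rw [h])) ..

end ParRAM

/-! ### Degree counting and the analysis of Stage I. -/

namespace CulledPartition

section Counting

open scoped Classical

variable {V : Type*}

theorem sum_degIn (G : SimpleGraph V) (S : Finset V) :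
    ∑ v ∈ S, degIn G S v = 2 * edgesIn G S := by
  have h := (G.induce (S : Set V)).sum_degrees_eq_twice_card_edges
  rw [edgesIn, Set.ncard_eq_toFinset_card', ← SimpleGraph.edgeFinset, ← h, ← Finset.sum_coe_sort]
  refine Finset.sum_congr rfl fun v _ => ?_
  rw [degIn, ← SimpleGraph.card_neighborFinset_eq_degree]
  refine (Finset.card_bij (fun u _ => u.1) ?_ ?_ ?_).symm
  · intro u hu
    simp only [SimpleGraph.mem_neighborFinset, SimpleGraph.comap_adj] at hu
    exact Finset.mem_filter.2 ⟨u.2, hu⟩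
  · intro u _ w _ h
    exact Subtype.ext h
  · intro u hu
    obtain ⟨h1, h2⟩ := Finset.mem_filter.1 hu
    exact ⟨⟨u, h1⟩, by simpa using h2, rfl⟩

theorem degIn_mono (G : SimpleGraph V) {S T : Finset V} (h : S ⊆ T) (v : V) :
    degIn G S v ≤ degIn G T v :=
  Finset.card_le_card (Finset.filter_subset_filter _ h)

theorem edgesIn_mono (G : SimpleGraph V) {S T : Finset V} (h : S ⊆ T) :
    edgesIn G S ≤ edgesIn G T := by
  have h1 := sum_degIn G S
  have h2 := sum_degIn G T
  have : ∑ v ∈ S, degIn G S v ≤ ∑ v ∈ T, degIn G T v :=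
    (Finset.sum_le_sum fun v _ => degIn_mono G h v).trans (Finset.sum_le_sum_of_subset h)
  omega

theorem card_filter_adj (G : SimpleGraph V) (S : Finset V) :
    {p ∈ S ×ˢ S | G.Adj p.1 p.2}.card = 2 * edgesIn G S := by
  rw [← sum_degIn, Finset.card_filter, Finset.sum_product]
  exact Finset.sum_congr rfl fun v _ => (Finset.card_filter ..).symm

variable [Fintype V]

theorem degIn_lt_card (G : SimpleGraph V) (S : Finset V) (v : V) :
    degIn G S v < Fintype.card V := by
  refine Finset.card_lt_card (Finset.ssubset_univ_iff.2 fun h => ?_)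
  have : v ∈ ({u ∈ S | G.Adj v u} : Finset V) := h ▸ Finset.mem_univ v
  simp at this

theorem two_mul_edgesIn_lt (G : SimpleGraph V) (S : Finset V) (h : 0 < Fintype.card V) :
    2 * edgesIn G S < Fintype.card V * Fintype.card V := by
  rw [← sum_degIn]
  calc ∑ v ∈ S, degIn G S v ≤ S.card • (Fintype.card V - 1) :=
        Finset.sum_le_card_nsmul _ _ _ fun v _ => Nat.le_sub_one_of_lt (degIn_lt_card G S v)
    _ ≤ Fintype.card V * (Fintype.card V - 1) :=
        Nat.mul_le_mul_right _ (Finset.card_le_univ S)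
    _ < Fintype.card V * Fintype.card V := Nat.mul_lt_mul_of_pos_left (by omega) h

theorem edgesIn_univ (G : SimpleGraph V) : edgesIn G Finset.univ = G.edgeSet.ncard := by
  have h1 := sum_degIn G Finset.univ
  have h2 := G.sum_degrees_eq_twice_card_edges
  rw [Set.ncard_eq_toFinset_card', ← SimpleGraph.edgeFinset]
  have : ∀ v, degIn G Finset.univ v = G.degree v := by
    intro v
    rw [degIn, ← SimpleGraph.card_neighborFinset_eq_degree]
    congr 1
    ext u
    simp
  simp only [this] at h1
  omega

/-- The vertices left by one round of Stage I. -/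
noncomputable def cull (G : SimpleGraph V) (k : ℕ) (S : Finset V) : Finset V :=
  {v ∈ S | (degIn G S v : ℝ) ≤ threshold G k S / 2}

/-- Clearing denominators turns the real comparison into one that the machine can perform exactly:
`2 e` is the length of the arc list, and the factor of `d` is a constant kept in a register. -/
theorem threshold_lt_iff (G : SimpleGraph V) {k : ℕ} (hk : 0 < k)
    (hV : 2 ≤ Fintype.card V) (S : Finset V) (d : ℕ) :
    threshold G k S < d ↔ 2 * edgesIn G S < d * (2 * k ^ 4 * Nat.clog 2 (Fintype.card V)) := by
  have hL : 0 < Nat.clog 2 (Fintype.card V) := Nat.clog_pos (by simp) hV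
  have : (0 : ℝ) < (k : ℝ) ^ 4 * (Nat.clog 2 (Fintype.card V) : ℝ) := by positivity
  rw [threshold, div_lt_iff₀ this, ← Nat.cast_lt (α := ℝ)]
  push_cast
  constructor <;> intro h <;> linarith

theorem le_threshold_iff (G : SimpleGraph V) {k : ℕ} (hk : 0 < k)
    (hV : 2 ≤ Fintype.card V) (S : Finset V) (d : ℕ) :
    (d : ℝ) ≤ threshold G k S / 2 ↔
      ¬ 2 * edgesIn G S < 2 * (d * (2 * k ^ 4 * Nat.clog 2 (Fintype.card V))) := by
  rw [← mul_assoc, ← threshold_lt_iff G hk hV, not_lt]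
  push_cast
  constructor <;> intro h <;> linarith

/-- The witness has degree above the new threshold, yet it survived with degree at most half of the
old one. Both thresholds have the same denominator, so the comparison passes to the edge counts. -/
theorem two_mul_edgesIn_cull_lt (G : SimpleGraph V) (k : ℕ) (S : Finset V)
    (h : ∃ v ∈ cull G k S, threshold G k (cull G k S) < degIn G (cull G k S) v) :
    2 * edgesIn G (cull G k S) < edgesIn G S := by
  obtain ⟨v, hv, hlt⟩ := h
  have h1 := (Finset.mem_filter.1 hv).2
  have h2 : (degIn G (cull G k S) v : ℝ) ≤ degIn G S v :=
    Nat.cast_le.2 (degIn_mono G (Finset.filter_subset _ _) v)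
  have h3 : threshold G k (cull G k S) < threshold G k S / 2 := by linarith
  -- With a vanishing denominator both thresholds would be `0` by the convention for division,
  -- contradicting `h3`.
  have hpos : (0 : ℝ) < (k : ℝ) ^ 4 * (Nat.clog 2 (Fintype.card V) : ℝ) := by
    by_contra hc
    have h0 : (k : ℝ) ^ 4 * (Nat.clog 2 (Fintype.card V) : ℝ) = 0 :=
      le_antisymm (not_lt.1 hc) (by positivity)
    simp [threshold, h0] at h3
  rw [threshold, threshold, div_right_comm] at h3
  have h4 : (edgesIn G (cull G k S) : ℝ) < edgesIn G S / 2 :=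
    (div_lt_div_iff_of_pos_right hpos).1 h3
  have h5 : (2 * edgesIn G (cull G k S) : ℝ) < edgesIn G S := by linarith
  exact_mod_cast h5

theorem survivors_of_exists (G : SimpleGraph V) (k : ℕ) (S : Finset V)
    (h : ∃ v ∈ S, threshold G k S < degIn G S v) :
    survivors G k S = survivors G k (cull G k S) := by
  rw [survivors, if_pos h, cull]

theorem survivors_of_not_exists (G : SimpleGraph V) (k : ℕ) (S : Finset V)
    (h : ¬ ∃ v ∈ S, threshold G k S < degIn G S v) : survivors G k S = S := by
  rw [survivors, if_neg h]

theorem edgesIn_pos_of_exists {G : SimpleGraph V} {k : ℕ} {S : Finset V}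
    (h : ∃ v ∈ S, threshold G k S < degIn G S v) : 0 < edgesIn G S := by
  obtain ⟨v, hv, hlt⟩ := h
  have h1 : 0 ≤ threshold G k S := by unfold threshold; positivity
  have h2 : 0 < degIn G S v := by exact_mod_cast h1.trans_lt hlt
  have h3 := sum_degIn G S
  have h4 := Finset.single_le_sum (f := degIn G S) (fun _ _ => Nat.zero_le _) hv
  omega

/-- Induction along the rounds of Stage I. -/
theorem survivors_induction {G : SimpleGraph V} {k : ℕ} {p : Finset V → Prop}
    (halt : ∀ S, (¬ ∃ v ∈ S, threshold G k S < degIn G S v) → p S)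
    (step : ∀ S, (∃ v ∈ S, threshold G k S < degIn G S v) → p (cull G k S) → p S)
    (S : Finset V) : p S := by
  induction S using Finset.strongInduction with
  | H S ih =>
    by_cases h : ∃ v ∈ S, threshold G k S < degIn G S v
    · refine step S h (ih _ ?_)
      obtain ⟨v, hv, hlt⟩ := h
      refine Finset.filter_ssubset.2 ⟨v, hv, ?_⟩
      have h0 : 0 ≤ threshold G k S := by unfold threshold; positivity
      linarith
    · exact halt S h

theorem degIn_survivors_le (G : SimpleGraph V) (k : ℕ) (S : Finset V) :
    ∀ v ∈ survivors G k S, (degIn G (survivors G k S) v : ℝ) ≤ threshold G k (survivors G k S) := by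
  induction S using survivors_induction (G := G) (k := k) with
  | halt S h =>
    rw [survivors_of_not_exists G k S h]
    push Not at h
    exact h
  | step S h ih =>
    rw [survivors_of_exists G k S h]
    exact ih

/-- Every removed vertex takes a share of more than `1 / (4 k⁴ L)` of the degree sum `2 e`.
Positivity of `e` is needed to cancel it. -/
theorem card_sdiff_cull_le (G : SimpleGraph V) {k : ℕ} (hk : 0 < k) (hV : 2 ≤ Fintype.card V)
    (S : Finset V) (hS : 0 < edgesIn G S) :
    (S \ cull G k S).card ≤ 4 * k ^ 4 * Nat.clog 2 (Fintype.card V) := by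
  set Q := 2 * k ^ 4 * Nat.clog 2 (Fintype.card V) with hQ
  have h1 : ∀ v ∈ S \ cull G k S, 2 * edgesIn G S ≤ 2 * (degIn G S v * Q) := by
    intro v hv
    obtain ⟨hv1, hv2⟩ := Finset.mem_sdiff.1 hv
    have : ¬ (degIn G S v : ℝ) ≤ threshold G k S / 2 := fun h =>
      hv2 (Finset.mem_filter.2 ⟨hv1, h⟩)
    rw [le_threshold_iff G hk hV, not_not] at this
    exact this.le
  have h2 := Finset.card_nsmul_le_sum _ _ _ h1
  rw [← Finset.mul_sum, ← Finset.sum_mul] at h2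
  have h3 : ∑ v ∈ S \ cull G k S, degIn G S v ≤ 2 * edgesIn G S := by
    rw [← sum_degIn]
    exact Finset.sum_le_sum_of_subset Finset.sdiff_subset
  have h4 : (S \ cull G k S).card * (2 * edgesIn G S) ≤ (2 * Q) * (2 * edgesIn G S) := by
    calc _ ≤ 2 * ((∑ v ∈ S \ cull G k S, degIn G S v) * Q) := h2
      _ ≤ 2 * (2 * edgesIn G S * Q) := by gcongr
      _ = _ := by ring
  refine (Nat.le_of_mul_le_mul_right h4 (by omega)).trans (le_of_eq ?_)
  rw [hQ]; ring

/-- The integer logarithm of the edge count serves as the potential that counts rounds. -/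
theorem log_edgesIn_cull_lt (G : SimpleGraph V) (k : ℕ) (S : Finset V)
    (h : ∃ v ∈ cull G k S, threshold G k (cull G k S) < degIn G (cull G k S) v) :
    Nat.log 2 (edgesIn G (cull G k S)) < Nat.log 2 (edgesIn G S) := by
  have h1 := two_mul_edgesIn_cull_lt G k S h
  have h2 := edgesIn_pos_of_exists h
  have h3 : Nat.log 2 (edgesIn G (cull G k S) * 2) = _ :=
    Nat.log_mul_base (by simp) (by omega)
  have h4 : Nat.log 2 (edgesIn G (cull G k S) * 2) ≤ Nat.log 2 (edgesIn G S) :=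
    Nat.log_mono_right (by omega)
  omega

theorem card_sdiff_survivors_le (G : SimpleGraph V) {k : ℕ} (hk : 0 < k)
    (hV : 2 ≤ Fintype.card V) (S : Finset V) :
    (S \ survivors G k S).card ≤
      4 * k ^ 4 * Nat.clog 2 (Fintype.card V) * (Nat.log 2 (edgesIn G S) + 1) := by
  induction S using survivors_induction (G := G) (k := k) with
  | halt S h => simp [survivors_of_not_exists G k S h]
  | step S h ih =>
    have h1 := card_sdiff_cull_le G hk hV S (edgesIn_pos_of_exists h)
    have h2 : S \ survivors G k S ⊆ (S \ cull G k S) ∪ (cull G k S \ survivors G k S) := by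
      intro v hv
      simp only [Finset.mem_union, Finset.mem_sdiff] at hv ⊢
      tauto
    have h3 := (Finset.card_le_card h2).trans (Finset.card_union_le _ _)
    rw [survivors_of_exists G k S h] at h3 ⊢
    -- Halving is known only when another round follows; the last round is paid for by the `+ 1` in
    -- the bound.
    by_cases hc : ∃ v ∈ cull G k S, threshold G k (cull G k S) < degIn G (cull G k S) v
    · have h4 := log_edgesIn_cull_lt G k S hc
      refine h3.trans ?_
      rw [mul_add, mul_one, add_comm]
      exact Nat.add_le_add (ih.trans (Nat.mul_le_mul_left _ h4)) h1
    · rw [survivors_of_not_exists _ _ _ hc, Finset.sdiff_self, Finset.card_empty, add_zero] at h3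
      rw [survivors_of_not_exists _ _ _ hc]
      exact h3.trans (h1.trans (Nat.le_mul_of_pos_right _ (by omega)))

end Counting

/-! ### Arc lists and adjacency arrays. -/

/-- The arcs of `G[S]` are `(src j, dst j)` for `j < M`; those with the same source as the `j`-th
one are at the positions `st j, …, en j - 1`. -/
structure IsArcList {n : ℕ} (G : SimpleGraph (Fin n)) (S : Finset (Fin n)) (M : ℕ)
    (src dst st en : ℕ → ℕ) : Prop where
  bijOn : Set.BijOn (fun j => (src j, dst j)) (Set.Iio M)
    {p | ∃ u ∈ S, ∃ v ∈ S, G.Adj u v ∧ p = (u.val, v.val)}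
  en_le : ∀ j < M, en j ≤ M
  segment : ∀ j < M, ∀ i < M, src i = src j ↔ st j ≤ i ∧ i < en j

namespace IsArcList

variable {n : ℕ} {G : SimpleGraph (Fin n)} {S : Finset (Fin n)} {M : ℕ} {src dst st en : ℕ → ℕ}

theorem congr (h : IsArcList G S M src dst st en) {src' dst' st' en' : ℕ → ℕ}
    (h1 : ∀ j < M, src' j = src j) (h2 : ∀ j < M, dst' j = dst j) (h3 : ∀ j < M, st' j = st j)
    (h4 : ∀ j < M, en' j = en j) : IsArcList G S M src' dst' st' en' where
  bijOn := h.bijOn.congr fun j hj => by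
    simp only [h1 j hj, h2 j hj]
  en_le j hj := (h4 j hj).trans_le (h.en_le j hj)
  segment j hj i hi := by rw [h1 j hj, h1 i hi, h3 j hj, h4 j hj, h.segment j hj i hi]

theorem exists_arc (h : IsArcList G S M src dst st en) {j : ℕ} (hj : j < M) :
    ∃ u ∈ S, ∃ v ∈ S, G.Adj u v ∧ src j = u ∧ dst j = v := by
  obtain ⟨u, hu, v, hv, ha, he⟩ := h.bijOn.mapsTo hj
  exact ⟨u, hu, v, hv, ha, (Prod.ext_iff.1 he).1, (Prod.ext_iff.1 he).2⟩

theorem exists_index (h : IsArcList G S M src dst st en) {u v : Fin n} (hu : u ∈ S) (hv : v ∈ S)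
    (ha : G.Adj u v) : ∃ j < M, src j = u ∧ dst j = v := by
  obtain ⟨j, hj, he⟩ := h.bijOn.surjOn ⟨u, hu, v, hv, ha, rfl⟩
  exact ⟨j, hj, (Prod.ext_iff.1 he).1, (Prod.ext_iff.1 he).2⟩

theorem eq_of_arc_eq (h : IsArcList G S M src dst st en) {i j : ℕ} (hi : i < M) (hj : j < M)
    (h1 : src i = src j) (h2 : dst i = dst j) : i = j :=
  h.bijOn.injOn hi hj (Prod.ext h1 h2)

/-- Within the segment of `u` the sources agree, so `dst` is injective there and its image is the
set of neighbours of `u` in `S`. -/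
theorem degree_eq (h : IsArcList G S M src dst st en) {j : ℕ} (hj : j < M) {u : Fin n}
    (hu : src j = u) : en j - st j = degIn G S u := by
  classical
  rw [← Nat.card_Ico, degIn, ← Finset.card_image_of_injOn (f := dst) (s := Finset.Ico _ _),
    ← Finset.card_image_of_injective {v ∈ S | G.Adj u v} Fin.val_injective]
  · congr 1
    ext x
    simp only [Finset.mem_image, Finset.mem_Ico, Finset.mem_filter]
    constructor
    · rintro ⟨i, ⟨h1, h2⟩, rfl⟩
      have hi : i < M := h2.trans_le (h.en_le j hj)
      obtain ⟨u', hu', v, hv, ha, h3, h4⟩ := h.exists_arc hi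
      rw [(h.segment j hj i hi).2 ⟨h1, h2⟩, hu] at h3
      obtain rfl := Fin.val_injective h3
      exact ⟨v, ⟨hv, ha⟩, h4.symm⟩
    · rintro ⟨v, ⟨hv, ha⟩, rfl⟩
      obtain ⟨u', hu', -, -, -, h3, -⟩ := h.exists_arc hj
      obtain rfl := Fin.val_injective (hu.symm.trans h3)
      obtain ⟨i, hi, h5, h6⟩ := h.exists_index hu' hv ha
      exact ⟨i, (h.segment j hj i hi).1 (h5.trans hu.symm), h6⟩
  · intro a ha b hb hab
    simp only [Finset.coe_Ico, Set.mem_Ico] at ha hb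
    have ha' := ha.2.trans_le (h.en_le j hj)
    have hb' := hb.2.trans_le (h.en_le j hj)
    exact h.eq_of_arc_eq ha' hb'
      (((h.segment j hj a ha').2 ha).trans ((h.segment j hj b hb').2 hb).symm) hab

theorem length_eq (h : IsArcList G S M src dst st en) : M = 2 * edgesIn G S := by
  classical
  rw [← card_filter_adj, ← Finset.card_range M]
  have hs : ∀ j < M, ∃ p : Fin n × Fin n, p.1 ∈ S ∧ p.2 ∈ S ∧ G.Adj p.1 p.2 ∧
      src j = p.1 ∧ dst j = p.2 := by
    intro j hj
    obtain ⟨u, hu, v, hv, ha, h1, h2⟩ := h.exists_arc hj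
    exact ⟨(u, v), hu, hv, ha, h1, h2⟩
  choose f hf using hs
  refine Finset.card_bij (fun j hj => f j (Finset.mem_range.1 hj)) ?_ ?_ ?_
  · intro j hj
    have := hf j (Finset.mem_range.1 hj)
    simp [this.1, this.2.1, this.2.2.1]
  · intro i hi j hj hij
    rw [Finset.mem_range] at hi hj
    have h1 := hf i hi
    have h2 := hf j hj
    rw [hij] at h1
    exact h.eq_of_arc_eq hi hj (h1.2.2.2.1.trans h2.2.2.2.1.symm)
      (h1.2.2.2.2.trans h2.2.2.2.2.symm)
  · rintro ⟨u, v⟩ hp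
    simp only [Finset.mem_filter, Finset.mem_product] at hp
    obtain ⟨j, hj, h1, h2⟩ := h.exists_index hp.1.1 hp.1.2 hp.2
    have h3 := hf j hj
    refine ⟨j, Finset.mem_range.2 hj, Prod.ext ?_ ?_⟩
    · exact Fin.val_injective (h3.2.2.2.1.symm.trans h1)
    · exact Fin.val_injective (h3.2.2.2.2.symm.trans h2)

theorem st_le (h : IsArcList G S M src dst st en) {j : ℕ} (hj : j < M) : st j ≤ j :=
  ((h.segment j hj j hj).1 rfl).1

theorem lt_en (h : IsArcList G S M src dst st en) {j : ℕ} (hj : j < M) : j < en j :=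
  ((h.segment j hj j hj).1 rfl).2

theorem _root_.Nat.exists_count_eq (F : ℕ → Prop) [DecidablePred F] {i M : ℕ}
    (h : i < Nat.count F M) : ∃ j < M, F j ∧ Nat.count F j = i := by
  induction M with
  | zero => simp at h
  | succ M ih =>
    by_cases h' : i < Nat.count F M
    · obtain ⟨j, hj, h1⟩ := ih h'
      exact ⟨j, by omega, h1⟩
    · rw [Nat.count_succ] at h
      split_ifs at h with hF
      · exact ⟨M, by omega, hF, by omega⟩
      · omega

/-- Only `i` has to be a kept position: `j` may be a segment boundary whose own arc is discarded.
This is what lets boundaries be renumbered by rank. -/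
theorem _root_.Nat.count_lt_count_iff (F : ℕ → Prop) [DecidablePred F] {i j : ℕ} (h : F i) :
    Nat.count F i < Nat.count F j ↔ i < j := by
  constructor
  · intro h1
    by_contra h2
    exact absurd (Nat.count_monotone F (not_lt.1 h2)) (by omega)
  · exact Nat.count_strict_mono h

/-- Removing the arcs with an end outside of `S'` and moving the others together. -/
theorem compact (h : IsArcList G S M src dst st en) {S' : Finset (Fin n)} (hS : S' ⊆ S)
    {F : ℕ → Prop} [DecidablePred F]
    (hF : ∀ j < M, ∀ u v : Fin n, src j = u → dst j = v → (F j ↔ u ∈ S' ∧ v ∈ S'))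
    {src' dst' st' en' : ℕ → ℕ}
    (h1 : ∀ j < M, F j → src' (Nat.count F j) = src j)
    (h2 : ∀ j < M, F j → dst' (Nat.count F j) = dst j)
    (h3 : ∀ j < M, F j → st' (Nat.count F j) = Nat.count F (st j))
    (h4 : ∀ j < M, F j → en' (Nat.count F j) = Nat.count F (en j)) :
    IsArcList G S' (Nat.count F M) src' dst' st' en' where
  bijOn := by
    refine ⟨?_, ?_, ?_⟩
    · intro i hi
      obtain ⟨j, hj, hFj, rfl⟩ := Nat.exists_count_eq F hi
      obtain ⟨u, -, v, -, ha, h5, h6⟩ := h.exists_arc hj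
      have := (hF j hj u v h5 h6).1 hFj
      exact ⟨u, this.1, v, this.2, ha, by simp only [h1 j hj hFj, h2 j hj hFj, h5, h6]⟩
    · intro i hi i' hi' he
      obtain ⟨j, hj, hFj, rfl⟩ := Nat.exists_count_eq F hi
      obtain ⟨j', hj', hFj', rfl⟩ := Nat.exists_count_eq F hi'
      simp only [h1 j hj hFj, h2 j hj hFj, h1 j' hj' hFj', h2 j' hj' hFj', Prod.mk.injEq] at he
      rw [h.eq_of_arc_eq hj hj' he.1 he.2]
    · rintro _ ⟨u, hu, v, hv, ha, rfl⟩
      obtain ⟨j, hj, h5, h6⟩ := h.exists_index (hS hu) (hS hv) ha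
      have hFj := (hF j hj u v h5 h6).2 ⟨hu, hv⟩
      exact ⟨Nat.count F j, (Nat.count_lt_count_iff F hFj).2 hj, by
        simp only [h1 j hj hFj, h2 j hj hFj, h5, h6]⟩
  en_le i hi := by
    obtain ⟨j, hj, hFj, rfl⟩ := Nat.exists_count_eq F hi
    rw [h4 j hj hFj]
    exact Nat.count_monotone F (h.en_le j hj)
  segment i hi i' hi' := by
    obtain ⟨j, hj, hFj, rfl⟩ := Nat.exists_count_eq F hi
    obtain ⟨j', hj', hFj', rfl⟩ := Nat.exists_count_eq F hi'
    -- Comparing the kept position `j'` with an old boundary is the same as comparing their ranks,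
    -- so segments go to segments.
    rw [h1 j hj hFj, h1 j' hj' hFj', h3 j hj hFj, h4 j hj hFj, h.segment j hj j' hj',
      Nat.count_lt_count_iff F hFj', ← not_lt, ← not_lt, Nat.count_lt_count_iff F hFj']

end IsArcList

namespace IsAdjacencyArray

variable {n : ℕ} {G : SimpleGraph (Fin n)} {off adj : ℕ → ℕ}

theorem off_mono (h : IsAdjacencyArray G off adj) {i j : ℕ} (hij : i ≤ j) (hj : j ≤ n) :
    off i ≤ off j := by
  induction j, hij using Nat.le_induction with
  | base => exact le_rfl
  | succ j hij ih => exact (ih (by omega)).trans (h.off_le ⟨j, hj⟩)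

theorem exists_segment (h : IsAdjacencyArray G off adj) {j m : ℕ} (hm : m ≤ n)
    (hj : j < off m) : ∃ v < m, off v ≤ j ∧ j < off (v + 1) := by
  induction m with
  | zero => rw [h.off_zero] at hj; omega
  | succ m ih =>
    by_cases h' : j < off m
    · obtain ⟨v, hv, h1⟩ := ih (by omega) h'
      exact ⟨v, by omega, h1⟩
    · exact ⟨m, by omega, by omega, hj⟩

theorem segment_unique (h : IsAdjacencyArray G off adj) {j u v : ℕ} (hu : u < n) (hv : v < n)
    (h1 : off u ≤ j) (h2 : j < off (u + 1)) (h3 : off v ≤ j) (h4 : j < off (v + 1)) : u = v := by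
  rcases lt_trichotomy u v with huv | huv | huv
  · have := h.off_mono (show u + 1 ≤ v from huv) hv.le
    omega
  · exact huv
  · have := h.off_mono (show v + 1 ≤ u from huv) hu.le
    omega

theorem isArcList (h : IsAdjacencyArray G off adj) {src dst st en : ℕ → ℕ}
    (h1 : ∀ v < n, ∀ j, off v ≤ j → j < off (v + 1) → src j = v)
    (h2 : ∀ j < off n, dst j = adj j) (h3 : ∀ j < off n, st j = off (src j))
    (h4 : ∀ j < off n, en j = off (src j + 1)) :
    IsArcList G Finset.univ (off n) src dst st en where
  bijOn := by
    refine ⟨?_, ?_, ?_⟩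
    · intro j hj
      obtain ⟨v, hv, h5, h6⟩ := h.exists_segment le_rfl hj
      obtain ⟨w, hw, h7⟩ := (h.bijOn ⟨v, hv⟩).mapsTo ⟨h5, h6⟩
      exact ⟨⟨v, hv⟩, Finset.mem_univ _, w, Finset.mem_univ _, hw,
        by simp only [h1 v hv j h5 h6, h2 j hj, h7]⟩
    · intro i hi j hj he
      obtain ⟨u, hu, h5, h6⟩ := h.exists_segment le_rfl hi
      obtain ⟨v, hv, h7, h8⟩ := h.exists_segment le_rfl hj
      simp only [h1 u hu i h5 h6, h1 v hv j h7 h8, h2 i hi, h2 j hj, Prod.mk.injEq] at he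
      obtain ⟨rfl, he⟩ := he
      exact (h.bijOn ⟨u, hu⟩).injOn ⟨h5, h6⟩ ⟨h7, h8⟩ he
    · rintro _ ⟨u, -, v, -, ha, rfl⟩
      obtain ⟨j, hj, h5⟩ := (h.bijOn u).surjOn ⟨v, ha, rfl⟩
      have hj' : j < off n := hj.2.trans_le (h.off_mono u.2 le_rfl)
      exact ⟨j, hj', by simp only [h1 u u.2 j hj.1 hj.2, h2 j hj', h5]⟩
  en_le j hj := by
    obtain ⟨v, hv, h5, h6⟩ := h.exists_segment le_rfl hj
    rw [h4 j hj, h1 v hv j h5 h6]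
    exact h.off_mono hv le_rfl
  segment j hj i hi := by
    obtain ⟨u, hu, h5, h6⟩ := h.exists_segment le_rfl hi
    obtain ⟨v, hv, h7, h8⟩ := h.exists_segment le_rfl hj
    rw [h3 j hj, h4 j hj, h1 v hv j h7 h8, h1 u hu i h5 h6]
    constructor
    · rintro rfl
      exact ⟨h5, h6⟩
    · rintro ⟨h9, h10⟩
      exact h.segment_unique hu hv h5 h6 h9 h10

/-- The adjacency array becomes an arc list once every position is assigned the vertex whose segment
contains it; the length formula for arc lists then applies. -/
theorem off_last (h : IsAdjacencyArray G off adj) : off n = 2 * edgesIn G Finset.univ := by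
  choose! f hf using fun (j : ℕ) (hj : j < off n) => h.exists_segment le_rfl hj
  exact (h.isArcList (src := f) (dst := adj) (st := fun j => off (f j))
    (en := fun j => off (f j + 1)) (fun v hv j h1 h2 => by
      have hj : j < off n := h2.trans_le (h.off_mono hv le_rfl)
      exact h.segment_unique (hf j hj).1 hv (hf j hj).2.1 (hf j hj).2.2 h1 h2)
    (fun _ _ => rfl) (fun _ _ => rfl) (fun _ _ => rfl)).length_eq

end IsAdjacencyArray

end CulledPartition

/-! ### Computing logarithms and compacting arrays. -/

namespace ParRAM

variable {W : ℕ} {ρ : ℕ → ℕ}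

/-- Register `c` receives the least `i` such that `2 ^ i` is at least `e`, and register `5` receives
`2 ^ i`. -/
def doubling (c : ℕ) (e : Exp) : Prog :=
  .seq (.set 5 (.lit 1)) (.seq (.set c (.lit 0))
    (.loop (.op .lt (.reg 5) e)
      (.seq (.set 5 (.op .add (.reg 5) (.reg 5))) (.set c (.op .add (.reg c) (.lit 1))))))

/-- Padding to a power of two at most doubles the size, so the tree passes stay linear in the number
of arcs. -/
theorem _root_.Nat.two_pow_clog_lt {N : ℕ} (h : 0 < N) : 2 ^ Nat.clog 2 N < 2 * N := by
  rcases Nat.lt_or_ge 1 N with h1 | h1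
  · have h2 := Nat.pow_pred_clog_lt_self (b := 2) (by simp) h1
    have h3 : 0 < Nat.clog 2 N := Nat.clog_pos (by simp) h1
    obtain ⟨i, hi⟩ : ∃ i, Nat.clog 2 N = i + 1 := ⟨Nat.clog 2 N - 1, by omega⟩
    rw [hi] at h2 ⊢
    simp only [Nat.pred_eq_sub_one, Nat.add_sub_cancel] at h2
    rw [pow_succ]
    omega
  · obtain rfl : N = 1 := by omega
    simp

theorem runs_doubling_loop {c N : ℕ} {e : Exp} (hc : c ≠ 5) (hN : 0 < N) (hW : 2 * N < W)
    (s : State)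
    (he : ∀ p i, e.eval W ρ ⟨Function.update (Function.update s.reg 5 p) c i, s.mem⟩ = N)
    (j i : ℕ) (hij : i + j = Nat.clog 2 N) :
    Runs W ρ (.loop (.op .lt (.reg 5) e)
        (.seq (.set 5 (.op .add (.reg 5) (.reg 5))) (.set c (.op .add (.reg c) (.lit 1)))))
      ⟨Function.update (Function.update s.reg 5 (2 ^ i)) c i, s.mem⟩
      ⟨Function.update (Function.update s.reg 5 (2 ^ Nat.clog 2 N)) c (Nat.clog 2 N), s.mem⟩
      ((e.size + 11) * (j + 1)) ((e.size + 11) * (j + 1)) := by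
  have h2 := Nat.two_pow_clog_lt hN
  have c1 : 1 % W = 1 := Nat.mod_eq_of_lt (by omega)
  induction j generalizing i with
  | zero =>
    obtain rfl : i = Nat.clog 2 N := hij
    refine (Runs.loopDone ?_).mono ?_ ?_
    · have := Nat.le_pow_clog (b := 2) (by simp) N
      simp only [Exp.eval, Op.apply, he, Function.update_of_ne hc.symm, Function.update_self]
      rw [if_neg (by omega)]
    · simp only [Exp.size]; omega
    · simp only [Exp.size]; omega
  | succ j ih =>
    have hlt : 2 ^ i < N := by
      rw [← Nat.lt_clog_iff_pow_lt (by simp)]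
      omega
    have hi : i < 2 ^ i := Nat.lt_two_pow_self
    have hset := Runs.set (W := W) (ρ := ρ) 5 (e := .op .add (.reg 5) (.reg 5))
      (s := ⟨Function.update (Function.update s.reg 5 (2 ^ i)) c i, s.mem⟩) (v := 2 ^ (i + 1))
      (by
        simp only [Exp.eval, Op.apply, Function.update_of_ne hc.symm, Function.update_self]
        rw [pow_succ, mul_two]
        exact Nat.mod_eq_of_lt (by omega))
    have hset' := Runs.set (W := W) (ρ := ρ) c (e := .op .add (.reg c) (.lit 1))
      (s := ⟨Function.update (Function.update (Function.update s.reg 5 (2 ^ i)) c i) 5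
        (2 ^ (i + 1)), s.mem⟩) (v := i + 1)
      (by
        simp only [Exp.eval, Op.apply, Function.update_of_ne hc, Function.update_self, c1]
        exact Nat.mod_eq_of_lt (by omega))
    have heq : Function.update (Function.update (Function.update (Function.update s.reg 5 (2 ^ i)) c
        i) 5 (2 ^ (i + 1))) c (i + 1)
        = Function.update (Function.update s.reg 5 (2 ^ (i + 1))) c (i + 1) := by
      rw [Function.update_comm hc, Function.update_idem, Function.update_idem]
    simp only [heq] at hset'
    refine (Runs.loopStep ?_ (hset.seq hset') (ih (i + 1) (by omega))).mono ?_ ?_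
    · simp only [Exp.eval, Op.apply, he, Function.update_of_ne hc.symm, Function.update_self]
      rw [if_pos hlt]
      simp
    · simp only [Exp.size]
      linarith
    · simp only [Exp.size]
      linarith

theorem runs_doubling {c N : ℕ} {e : Exp} (hc : c ≠ 5) (hN : 0 < N) (hW : 2 * N < W)
    (s : State)
    (he : ∀ p i, e.eval W ρ ⟨Function.update (Function.update s.reg 5 p) c i, s.mem⟩ = N) :
    Runs W ρ (doubling c e) s
      ⟨Function.update (Function.update s.reg 5 (2 ^ Nat.clog 2 N)) c (Nat.clog 2 N), s.mem⟩
      ((e.size + 15) * (Nat.clog 2 N + 1)) ((e.size + 15) * (Nat.clog 2 N + 1)) := by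
  have c1 : 1 % W = 1 := Nat.mod_eq_of_lt (by omega)
  have h1 := Runs.set (W := W) (ρ := ρ) 5 (e := .lit 1) (s := s) (v := 1) (by simp [Exp.eval, c1])
  have h2 := Runs.set (W := W) (ρ := ρ) c (e := .lit 0)
    (s := ⟨Function.update s.reg 5 1, s.mem⟩) (v := 0) (by simp [Exp.eval])
  have h3 := runs_doubling_loop hc hN hW s he _ 0 (zero_add _)
  refine (h1.seq (h2.seq h3)).mono ?_ ?_
  · simp only [Exp.size]
    linarith
  · simp only [Exp.size]
    linarith

/-- The positions `x < M` marked in the leaves of the tree in array `7` are moved together, in this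
order, in array `A`, with new entries `e`. -/
def compact (A : ℕ) (e : Exp) : Prog :=
  .seq (scatter 8 (.reg 4) (.get 7 (.op .add (.reg 5) (.reg 8))) 9
      (.get 8 (.op .add (.reg 5) (.reg 8))) e)
    (scatter 8 (.get 8 (.op .add (.reg 5) (.reg 4))) (.lit 1) A (.reg 8) (.get 9 (.reg 8)))

/-- The rank of a marked position among the marked ones is its new address. Moving entries within
`A` directly would race, since one thread's target can be another thread's source; hence the detour
through array `9`. -/
theorem runs_compact {s : State} {A M h : ℕ} {e : Exp} {F : ℕ → Prop} [DecidablePred F]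
    {g : ℕ → ℕ} (hM : s.reg 4 = M) (hq : s.reg 5 = 2 ^ h) (hMh : M < 2 ^ h)
    (hW : 2 ^ (h + 1) < W) (hT : ∀ j < M, s.mem (7, 2 ^ h + j) ≠ 0 ↔ F j)
    (hP : ∀ j ≤ M, s.mem (8, 2 ^ h + j) = Nat.count F j)
    (hA : A ≠ 9) (he : 9 ∉ e.arrays)
    (hg : ∀ j < M, F j → e.eval W ρ (s.thread 8 j) = g j) :
    ∃ μ, Runs W ρ (compact A e) s ⟨s.reg, μ⟩ ((30 + e.size) * (M + 1)) (40 + e.size) ∧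
      (∀ j < M, F j → μ (A, Nat.count F j) = g j) ∧
      ∀ l, l.1 ≠ A → l.1 ≠ 9 → μ l = s.mem l := by
  rw [pow_succ] at hW
  have c1 : 1 % W = 1 := Nat.mod_eq_of_lt (by omega)
  have e1 : ∀ j < 2 ^ h, (2 ^ h + j) % W = 2 ^ h + j := fun j hj => Nat.mod_eq_of_lt (by omega)
  obtain ⟨μ, h1, h2, h3⟩ := Runs.exists_scatter_of_notMem (W := W) (ρ := ρ) (x := 8) (A := 9)
    (s := s) (N := M) (eN := .reg 4) (b := .get 7 (.op .add (.reg 5) (.reg 8)))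
    (idx := .get 8 (.op .add (.reg 5) (.reg 8))) (e := e) hM F (Nat.count F) g
    (by simp [Exp.arrays, he])
    (fun i hi => by
      simp [Exp.eval, Op.apply, State.thread, hq, e1 i (by omega), ← hT i hi])
    (fun i hi _ => by
      simp [Exp.eval, Op.apply, State.thread, hq, e1 i (by omega), hP i hi.le])
    hg (fun i _ j _ hi hj => Nat.count_injective hi hj)
  have hcount := Nat.count_le (p := F) (n := M)
  obtain ⟨ν, h4, h5, h6⟩ := Runs.exists_scatter_of_notMem (W := W) (ρ := ρ) (x := 8) (A := A)
    (s := ⟨s.reg, μ⟩) (N := Nat.count F M) (eN := .get 8 (.op .add (.reg 5) (.reg 4)))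
    (b := .lit 1) (idx := .reg 8) (e := .get 9 (.reg 8))
    (by
      -- The total number of marked positions is the prefix sum at leaf `M`; the strict inequality
      -- `M < 2 ^ h` guarantees that this leaf exists.
      simp only [Exp.eval, Op.apply, hq, hM, e1 M hMh]
      rw [h3 _ (by simp), hP M le_rfl])
    (fun _ => True) (fun i => i) (fun i => μ (9, i))
    (by simp [Exp.arrays, hA])
    (fun i hi => by simp [Exp.eval, c1])
    (fun i hi _ => by simp [Exp.eval, State.thread])
    (fun i hi _ => by simp [Exp.eval, State.thread])
    (fun i _ j _ _ _ hij => hij)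
  refine ⟨ν, (h1.seq h4).mono ?_ ?_, ?_, ?_⟩
  · simp only [Exp.size]
    nlinarith
  · simp only [Exp.size]
    omega
  · intro j hj hF
    rw [h5 _ (Nat.count_strict_mono hF hj) trivial, h2 j hj hF]
  · intro l hl hl'
    exact (h6 l fun i _ _ h => hl (by rw [h])).trans (h3 l fun i _ _ h => hl' (by rw [h]))

end ParRAM

/-! ### The machine representation of `G[S]`, the halting test and the marking of vertices. -/

namespace CulledPartition

open ParRAM

variable {W : ℕ} {ρ : ℕ → ℕ} {n k : ℕ} {G : SimpleGraph (Fin n)} {ω : Fin n → Fin k}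
  {S : Finset (Fin n)} {s : State}

/-- The words are long enough for all numbers that the algorithm handles. -/
structure WordBound (n k W : ℕ) : Prop where
  two_le : 2 ≤ n
  one_le : 1 ≤ k
  sq : 4 * (n * n) < W
  scaled : 2 * (n * (2 * k ^ 4 * Nat.clog 2 n)) < W

/-- The state `s` represents the graph `G[S]`, the complement of `S` and the labels. -/
structure Represents (G : SimpleGraph (Fin n)) (ω : Fin n → Fin k) (S : Finset (Fin n))
    (s : State) : Prop where
  reg_zero : s.reg 0 = n
  reg_three : s.reg 3 = 2 * k ^ 4 * Nat.clog 2 n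
  arcs : IsArcList G S (s.reg 4) (fun j => s.mem (4, j)) (fun j => s.mem (1, j))
    (fun j => s.mem (5, j)) (fun j => s.mem (6, j))
  culled : ∀ v : Fin n, s.mem (2, v) = if v ∈ S then 0 else 1
  label : ∀ v : Fin n, s.mem (3, v) = ω v

/-- Arrays from `7` on are scratch space. -/
theorem Represents.congr (h : Represents G ω S s) {t : State} (h0 : t.reg 0 = s.reg 0)
    (h3 : t.reg 3 = s.reg 3) (h4 : t.reg 4 = s.reg 4) (hm : ∀ l, l.1 < 7 → t.mem l = s.mem l) :
    Represents G ω S t where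
  reg_zero := h0.trans h.reg_zero
  reg_three := h3.trans h.reg_three
  arcs := by
    rw [h4]
    exact h.arcs.congr (fun _ _ => hm _ (by simp)) (fun _ _ => hm _ (by simp))
      (fun _ _ => hm _ (by simp)) (fun _ _ => hm _ (by simp))
  culled v := (hm _ (by simp)).trans (h.culled v)
  label v := (hm _ (by simp)).trans (h.label v)

theorem WordBound.length_lt (hW : WordBound n k W) (G : SimpleGraph (Fin n))
    (S : Finset (Fin n)) : 2 * edgesIn G S < n * n := by
  simpa using two_mul_edgesIn_lt G S (by
    have := hW.two_le
    simpa using (by omega : 0 < n))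

theorem WordBound.pow_lt (hW : WordBound n k W) (G : SimpleGraph (Fin n)) (S : Finset (Fin n)) :
    2 ^ (Nat.clog 2 (2 * edgesIn G S + 1) + 1) < W := by
  have h1 := hW.length_lt G S
  have h2 := Nat.two_pow_clog_lt (N := 2 * edgesIn G S + 1) (by omega)
  have h3 := hW.sq
  rw [pow_succ]
  omega

theorem WordBound.degree_lt (hW : WordBound n k W) (G : SimpleGraph (Fin n))
    (S : Finset (Fin n)) (v : Fin n) :
    2 * (degIn G S v * (2 * k ^ 4 * Nat.clog 2 n)) < W := by
  have h1 : degIn G S v < n := by simpa using degIn_lt_card G S v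
  refine lt_of_le_of_lt ?_ hW.scaled
  gcongr

/-- It absorbs the sequential work of the doubling loop into the work bound that is linear in the
number of arcs. -/
theorem clog_succ_le (M : ℕ) : Nat.clog 2 (M + 1) ≤ M := by
  rw [Nat.clog_le_iff_le_pow (by simp)]
  exact Nat.lt_two_pow_self

/-- Counts, at the root of the tree in array `7`, the arcs whose source has degree greater than the
threshold. -/
def check : Prog :=
  .seq (doubling 7 (.op .add (.reg 4) (.lit 1)))
    (.seq (scatter 8 (.reg 5) (.lit 1) 7 (.op .add (.reg 5) (.reg 8))
      (.op .mul (.op .lt (.reg 8) (.reg 4))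
        (.op .lt (.reg 4) (.op .mul (.op .sub (.get 6 (.reg 8)) (.get 5 (.reg 8))) (.reg 3)))))
      upsweep)

theorem Represents.exists_arc_of_degree (h : Represents G ω S s) {v : Fin n} (hv : v ∈ S)
    (hd : 0 < degIn G S v) : ∃ j < s.reg 4, s.mem (4, j) = v := by
  classical
  obtain ⟨u, hu⟩ := Finset.card_pos.1 hd
  obtain ⟨h1, h2⟩ := Finset.mem_filter.1 hu
  obtain ⟨j, hj, h3, -⟩ := h.arcs.exists_index hv h1 h2
  exact ⟨j, hj, h3⟩

/-- Testing arcs instead of vertices keeps the work independent of `n`. Nothing is missed, because a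
vertex above the threshold has positive degree and is the source of some arc. -/
theorem runs_check (hW : WordBound n k W) (h : Represents G ω S s) :
    ∃ t, Runs W ρ check s t (170 * (2 * edgesIn G S + 1))
        (100 * (Nat.clog 2 (2 * edgesIn G S + 1) + 1)) ∧ Represents G ω S t ∧
      t.reg 6 = s.reg 6 ∧ t.reg 5 = 2 ^ Nat.clog 2 (2 * edgesIn G S + 1) ∧
      (t.mem (7, 1) ≠ 0 ↔ ∃ v ∈ S, threshold G k S < degIn G S v) := by
  have hM := h.arcs.length_eq
  have hlt := hW.length_lt G S
  have hpow := hW.pow_lt G S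
  have hpow' := hpow
  have h2 := hW.two_le
  have hsq := hW.sq
  set M := 2 * edgesIn G S with hMdef
  have hclog := Nat.two_pow_clog_lt (N := M + 1) (by omega)
  have hlog := clog_succ_le M
  have hMq : M + 1 ≤ 2 ^ Nat.clog 2 (M + 1) := Nat.le_pow_clog (by simp) _
  have c1 : 1 % W = 1 := Nat.mod_eq_of_lt (by omega)
  have hdouble := runs_doubling (W := W) (ρ := ρ) (c := 7) (N := M + 1)
    (e := .op .add (.reg 4) (.lit 1)) (by simp) (by omega) (by omega) s
    (fun p i => by
      simp [Exp.eval, Op.apply, hM, c1]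
      exact Nat.mod_eq_of_lt (by omega))
  set q := Nat.clog 2 (M + 1) with hq
  rw [pow_succ] at hpow'
  set s' : State := ⟨Function.update (Function.update s.reg 5 (2 ^ q)) 7 q, s.mem⟩ with hs'
  let big : ℕ → ℕ := fun i =>
    if i < M ∧ M < (s.mem (6, i) - s.mem (5, i)) * (2 * k ^ 4 * Nat.clog 2 n) then 1 else 0
  have hdeg : ∀ i < M, ∃ u ∈ S, s.mem (4, i) = u ∧
      s.mem (6, i) - s.mem (5, i) = degIn G S u := by
    intro i hi
    rw [← hM] at hi
    obtain ⟨u, hu, -, -, -, h1, -⟩ := h.arcs.exists_arc hi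
    exact ⟨u, hu, h1, h.arcs.degree_eq hi h1⟩
  have hbig : ∀ i, big i ≤ 1 := fun i => by simp only [big]; split_ifs <;> simp
  have hsum : ∑ x ∈ Finset.range (2 ^ q), big x < W := by
    have := Finset.sum_le_card_nsmul (Finset.range (2 ^ q)) big 1 fun i _ => hbig i
    simp only [Finset.card_range, smul_eq_mul, mul_one] at this
    exact this.trans_lt (by omega)
  obtain ⟨μ, hfill, h3, h4⟩ := Runs.exists_scatter_of_notMem (W := W) (ρ := ρ) (x := 8) (A := 7)
    (s := s') (N := 2 ^ q) (eN := .reg 5) (b := .lit 1) (idx := .op .add (.reg 5) (.reg 8))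
    (e := .op .mul (.op .lt (.reg 8) (.reg 4))
      (.op .lt (.reg 4) (.op .mul (.op .sub (.get 6 (.reg 8)) (.get 5 (.reg 8))) (.reg 3))))
    (by simp [Exp.eval, s']) (fun _ => True) (fun i => 2 ^ q + i) big
    (by simp [Exp.arrays]) (fun i _ => by simp [Exp.eval, c1])
    (fun i hi _ => by
      simp [Exp.eval, Op.apply, State.thread, s']
      exact Nat.mod_eq_of_lt (by omega))
    (fun i hi _ => by
      simp only [Exp.eval, Op.apply, State.thread, s', ne_eq, Nat.reduceEqDiff, not_false_eq_true,
        Function.update_of_ne, Function.update_self, hM, h.reg_three, big]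
      by_cases hiM : i < M
      · obtain ⟨u, -, -, hu⟩ := hdeg i hiM
        have hb := hW.degree_lt G S u
        rw [hu, Nat.mod_eq_of_lt (a := degIn G S u * _) (by omega)]
        simp only [hiM, if_true, true_and, one_mul]
        split_ifs
        · exact c1
        · simp
      -- Cells beyond the current arc list may hold leftovers of earlier rounds; the factor `i < M`
      -- evaluates to `0` and discards them.
      · simp [hiM])
    (fun i _ j _ _ _ hij => by simpa using hij)
  obtain ⟨t, hup, h5, h6, h7⟩ := runs_upsweep (ρ := ρ) (a := big) hpow hsum ⟨s'.reg, μ⟩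
    (by simp [s']) (fun x hx => h3 x hx trivial)
  refine ⟨t, (hdouble.seq (hfill.seq hup)).mono ?_ ?_, ?_, ?_, ?_, ?_⟩
  · simp only [Exp.size]
    omega
  · simp only [Exp.size]
    omega
  · refine h.congr ?_ ?_ ?_ ?_
    · rw [h5 0 (by simp)]; simp [s']
    · rw [h5 3 (by simp)]; simp [s']
    · rw [h5 4 (by simp)]; simp [s']
    · intro l hl
      rw [h6 l (by omega)]
      exact h4 l fun i _ _ hi => by rw [hi] at hl; simp at hl
  · rw [h5 6 (by simp)]; simp [s']
  · rw [h5 5 (by simp)]; simp [s']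
  · have hroot := h7 0 (by simp) 0 (by simp)
    simp only [pow_zero, add_zero, Nat.sub_zero, blockSum, zero_mul, zero_add] at hroot
    rw [hroot, ne_eq, Finset.sum_eq_zero_iff]
    push Not
    constructor
    · rintro ⟨i, hi, hne⟩
      simp only [big, ne_eq, ite_eq_right_iff, one_ne_zero, imp_false, not_not] at hne
      obtain ⟨u, hu, -, hd⟩ := hdeg i hne.1
      refine ⟨u, hu, (threshold_lt_iff G hW.one_le (by simpa using h2) S _).2 ?_⟩
      rw [← hd]
      simpa using hne.2
    · rintro ⟨v, hv, hlt⟩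
      have hlt' := (threshold_lt_iff G hW.one_le (by simpa using h2) S _).1 hlt
      have hd : 0 < degIn G S v := by
        by_contra hd
        rw [show degIn G S v = 0 by omega] at hlt'
        simp at hlt'
      obtain ⟨j, hj, hjv⟩ := h.exists_arc_of_degree hv hd
      refine ⟨j, Finset.mem_range.2 (by omega), ?_⟩
      simp only [big, ne_eq, ite_eq_right_iff, one_ne_zero, imp_false, not_not]
      refine ⟨by omega, ?_⟩
      rw [h.arcs.degree_eq hj hjv]
      simpa using hlt'

/-- Marks, in array `2`, the vertices whose degree is greater than half of the threshold. -/
def mark : Prog :=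
  scatter 8 (.reg 4)
    (.op .mul (.op .eq (.get 5 (.reg 8)) (.reg 8))
      (.op .lt (.reg 4)
        (.op .mul (.lit 2) (.op .mul (.op .sub (.get 6 (.reg 8)) (.get 5 (.reg 8))) (.reg 3)))))
    2 (.get 4 (.reg 8)) (.lit 1)

theorem mem_cull_iff (hW : WordBound n k W) {v : Fin n} (hv : v ∈ S) :
    v ∈ cull G k S ↔
      ¬ 2 * edgesIn G S < 2 * (degIn G S v * (2 * k ^ 4 * Nat.clog 2 n)) := by
  have := le_threshold_iff G hW.one_le (by simpa using hW.two_le) S (degIn G S v)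
  rw [Fintype.card_fin] at this
  rw [← this]
  exact Finset.mem_filter.trans (and_iff_right hv)

/-- All arcs of a segment know that their source is to be removed, but only one may write. The arc
at the start of the segment, recognised by `st i = i`, is elected. -/
theorem runs_mark (hW : WordBound n k W) (h : Represents G ω S s) :
    ∃ μ, Runs W ρ mark s ⟨s.reg, μ⟩ (30 * (2 * edgesIn G S + 1)) 30 ∧
      (∀ v : Fin n, μ (2, v) = if v ∈ cull G k S then 0 else 1) ∧
      ∀ l, l.1 ≠ 2 → μ l = s.mem l := by
  have hM := h.arcs.length_eq
  have hsq := hW.sq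
  have h2 := hW.two_le
  have hsq' : 2 * 2 ≤ n * n := Nat.mul_le_mul h2 h2
  set M := 2 * edgesIn G S with hMdef
  have c1 : 1 % W = 1 := Nat.mod_eq_of_lt (by omega)
  have c2 : 2 % W = 2 := Nat.mod_eq_of_lt (by omega)
  have hdeg : ∀ i < M, ∃ u ∈ S, s.mem (4, i) = u ∧
      s.mem (6, i) - s.mem (5, i) = degIn G S u := by
    intro i hi
    rw [← hM] at hi
    obtain ⟨u, hu, -, -, -, h1, -⟩ := h.arcs.exists_arc hi
    exact ⟨u, hu, h1, h.arcs.degree_eq hi h1⟩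
  obtain ⟨μ, hrun, h3, h4⟩ := Runs.exists_scatter_of_notMem (W := W) (ρ := ρ) (x := 8) (A := 2)
    (s := s) (N := M) (eN := .reg 4)
    (b := .op .mul (.op .eq (.get 5 (.reg 8)) (.reg 8))
      (.op .lt (.reg 4)
        (.op .mul (.lit 2) (.op .mul (.op .sub (.get 6 (.reg 8)) (.get 5 (.reg 8))) (.reg 3)))))
    (idx := .get 4 (.reg 8)) (e := .lit 1) hM
    (fun i => s.mem (5, i) = i ∧
      M < 2 * ((s.mem (6, i) - s.mem (5, i)) * (2 * k ^ 4 * Nat.clog 2 n)))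
    (fun i => s.mem (4, i)) (fun _ => 1)
    (by simp [Exp.arrays])
    (fun i hi => by
      obtain ⟨u, -, -, hu⟩ := hdeg i hi
      have hb := hW.degree_lt G S u
      simp only [Exp.eval, Op.apply, State.thread, ne_eq, Nat.reduceEqDiff, not_false_eq_true,
        Function.update_of_ne, Function.update_self, hM, h.reg_three, hu, c2]
      rw [Nat.mod_eq_of_lt (a := degIn G S u * _) (by omega), Nat.mod_eq_of_lt hb]
      by_cases h5 : s.mem (5, i) = i
      · simp only [h5, if_true, one_mul, true_and]
        split_ifs with h6 <;> simp [h6, c1]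
      · simp [h5])
    (fun i _ _ => by simp [Exp.eval, State.thread])
    (fun i _ _ => by simp [Exp.eval, c1])
    -- Two elected arcs with the same source lie in each other's segment, and each is the start of
    -- its own, so they coincide.
    (fun i hi j hj hPi hPj hij => by
      have hi' := (h.arcs.segment j (by omega) i (by omega)).1 hij
      have hj' := (h.arcs.segment i (by omega) j (by omega)).1 hij.symm
      simp only [hPi.1, hPj.1] at hi' hj'
      omega)
  refine ⟨μ, hrun.mono ?_ ?_, ?_, ?_⟩
  · simp only [Exp.size]
    omega
  · simp only [Exp.size]
    omega
  · intro v
    by_cases hv : v ∈ S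
    · by_cases hc : v ∈ cull G k S
      · rw [if_pos hc, h4, h.culled, if_pos hv]
        rintro i hi ⟨-, hlt⟩ heq
        have hiv : s.mem (4, i) = v := ((Prod.ext_iff.1 heq).2).symm
        rw [h.arcs.degree_eq (by omega) hiv] at hlt
        exact (mem_cull_iff hW hv).1 hc hlt
      · rw [if_neg hc]
        rw [mem_cull_iff hW hv, not_not] at hc
        have hd : 0 < degIn G S v := by
          by_contra hd
          rw [show degIn G S v = 0 by omega] at hc
          simp at hc
        obtain ⟨j, hj, hjv⟩ := h.exists_arc_of_degree hv hd
        -- The start of the segment of `j` is the arc that marks `v`; it remains to see that it is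
        -- its own segment start.
        set i := s.mem (5, j) with hi
        have hij : i ≤ j := h.arcs.st_le hj
        have hiM : i < s.reg 4 := by omega
        have hjen : j < s.mem (6, j) := h.arcs.lt_en hj
        have hsrc : s.mem (4, i) = s.mem (4, j) :=
          (h.arcs.segment j hj i hiM).2 ⟨le_rfl, by omega⟩
        have hst : s.mem (5, i) ≤ i := h.arcs.st_le hiM
        have hst' : s.mem (5, i) = i := by
          refine le_antisymm hst ?_
          have hlt : s.mem (5, i) < s.reg 4 := by omega
          have hen : i < s.mem (6, i) := h.arcs.lt_en hiM
          have h5 : s.mem (4, s.mem (5, i)) = s.mem (4, i) :=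
            (h.arcs.segment i hiM _ hlt).2 ⟨le_rfl, by omega⟩
          exact ((h.arcs.segment j hj _ hlt).1 (h5.trans hsrc)).1
        have := h3 i (by omega) ⟨hst', by
          rw [h.arcs.degree_eq hiM (hsrc.trans hjv)]
          exact hc⟩
        rwa [hsrc, hjv] at this
    · have hc : v ∉ cull G k S := fun hc => hv (Finset.mem_filter.1 hc).1
      rw [if_neg hc, h4, h.culled, if_neg hv]
      rintro i hi - heq
      obtain ⟨u, hu, h5, -⟩ := hdeg i hi
      have hiv : s.mem (4, i) = v := ((Prod.ext_iff.1 heq).2).symm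
      exact hv (Fin.val_injective (hiv.symm.trans h5) ▸ hu)
  · intro l hl
    exact h4 l fun i _ _ hi => hl (by rw [hi])

end CulledPartition

/-! ### One round of Stage I: ranking the surviving arcs and rebuilding the list. -/

namespace ParRAM

variable {W : ℕ} {ρ : ℕ → ℕ}

/-- Marks the arcs both ends of which are unmarked in array `2`, and counts the marked arcs before
every position. -/
def scan : Prog :=
  .seq (scatter 8 (.reg 5) (.lit 1) 7 (.op .add (.reg 5) (.reg 8))
      (.op .mul (.op .lt (.reg 8) (.reg 4))
        (.op .mul (.op .eq (.get 2 (.get 4 (.reg 8))) (.lit 0))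
          (.op .eq (.get 2 (.get 1 (.reg 8))) (.lit 0)))))
    (.seq upsweep downsweep)

theorem runs_scan {s : State} {q M : ℕ} (hM : s.reg 4 = M) (hq : s.reg 5 = 2 ^ q)
    (hMq : M < 2 ^ q) (hW : 2 ^ (q + 1) < W) (F : ℕ → Prop) [DecidablePred F]
    (hF : ∀ j, F j ↔ j < M ∧ s.mem (2, s.mem (4, j)) = 0 ∧ s.mem (2, s.mem (1, j)) = 0) :
    ∃ t, Runs W ρ scan s t (220 * 2 ^ q) (120 * (q + 1)) ∧
      (∀ x, x ≠ 7 → t.reg x = s.reg x) ∧ (∀ l, l.1 < 7 → t.mem l = s.mem l) ∧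
      (∀ j < M, t.mem (7, 2 ^ q + j) ≠ 0 ↔ F j) ∧
      ∀ j ≤ M, t.mem (8, 2 ^ q + j) = Nat.count F j := by
  have hW' := hW
  rw [pow_succ] at hW'
  have hpos : 0 < 2 ^ q := by positivity
  have c1 : 1 % W = 1 := Nat.mod_eq_of_lt (by omega)
  let a : ℕ → ℕ := fun i => if F i then 1 else 0
  have hcount : ∀ j, ∑ i ∈ Finset.range j, a i = Nat.count F j := by
    intro j
    rw [Nat.count_eq_card_filter_range, Finset.card_filter]
  -- The leaves are indicators, so their sum is at most the number of leaves and the tree sums do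
  -- not wrap around.
  have hsum : ∑ i ∈ Finset.range (2 ^ q), a i < W := by
    rw [hcount]
    exact (Nat.count_le (p := F)).trans_lt (by omega)
  obtain ⟨μ, hfill, h1, h2⟩ := Runs.exists_scatter_of_notMem (W := W) (ρ := ρ) (x := 8) (A := 7)
    (s := s) (N := 2 ^ q) (eN := .reg 5) (b := .lit 1) (idx := .op .add (.reg 5) (.reg 8))
    (e := .op .mul (.op .lt (.reg 8) (.reg 4))
        (.op .mul (.op .eq (.get 2 (.get 4 (.reg 8))) (.lit 0))
          (.op .eq (.get 2 (.get 1 (.reg 8))) (.lit 0))))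
    hq (fun _ => True) (fun i => 2 ^ q + i) a
    (by simp [Exp.arrays]) (fun i _ => by simp [Exp.eval, c1])
    (fun i hi _ => by
      simp [Exp.eval, Op.apply, State.thread, hq]
      exact Nat.mod_eq_of_lt (by omega))
    (fun i hi _ => by
      simp only [Exp.eval, Op.apply, State.thread, ne_eq, Nat.reduceEqDiff, not_false_eq_true,
        Function.update_of_ne, Function.update_self, hM, hF, a, Nat.zero_mod]
      by_cases h1 : i < M <;> by_cases h2 : s.mem (2, s.mem (4, i)) = 0 <;>
        by_cases h3 : s.mem (2, s.mem (1, i)) = 0 <;> simp [h1, h2, h3, c1])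
    (fun i _ j _ _ _ hij => by simpa using hij)
  obtain ⟨t, hup, h3, h4, h5⟩ := runs_upsweep (ρ := ρ) (a := a) hW hsum ⟨s.reg, μ⟩ hq
    (fun x hx => h1 x hx trivial)
  obtain ⟨u, hdown, h6, h7, h8⟩ := runs_downsweep (ρ := ρ) hW hsum t
    ((h3 5 (by simp)).trans hq) h5
  refine ⟨u, (hfill.seq (hup.seq hdown)).mono ?_ ?_, ?_, ?_, ?_, ?_⟩
  · simp only [Exp.size]
    omega
  · simp only [Exp.size]
    omega
  · intro x hx
    exact (h6 x hx).trans (h3 x hx)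
  · intro l hl
    rw [h7 l (by omega), h4 l (by omega)]
    exact h2 l fun i _ _ hi => by rw [hi] at hl; simp at hl
  · intro j hj
    rw [h7 _ (by simp), h5 q le_rfl j (by omega)]
    simp [blockSum, a]
  · intro j hj
    rw [h8 j (by omega), hcount]

end ParRAM

namespace CulledPartition

open ParRAM

variable {W : ℕ} {ρ : ℕ → ℕ} {n k : ℕ} {G : SimpleGraph (Fin n)} {ω : Fin n → Fin k}
  {S : Finset (Fin n)} {s : State}

/-- One round of Stage I. -/
def round : Prog :=
  .seq mark (.seq scan
    (.seq (compact 4 (.get 4 (.reg 8))) (.seq (compact 1 (.get 1 (.reg 8)))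
      (.seq (compact 5 (.get 8 (.op .add (.reg 5) (.get 5 (.reg 8)))))
        (.seq (compact 6 (.get 8 (.op .add (.reg 5) (.get 6 (.reg 8)))))
          (.set 4 (.get 8 (.op .add (.reg 5) (.reg 4)))))))))

/-- Sources and targets are moved unchanged, whereas the entries of arrays `5` and `6` are positions
and are replaced by their ranks. The tree size in register `5` is inherited from the halting test.
Register `4` is overwritten last, as every compaction needs the old length. -/
theorem runs_round (hW : WordBound n k W) (h : Represents G ω S s)
    (hq : s.reg 5 = 2 ^ Nat.clog 2 (2 * edgesIn G S + 1)) :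
    ∃ t, Runs W ρ round s t (700 * (2 * edgesIn G S + 1))
        (350 * (Nat.clog 2 (2 * edgesIn G S + 1) + 1)) ∧ Represents G ω (cull G k S) t ∧
      t.reg 6 = s.reg 6 := by
  classical
  have hM := h.arcs.length_eq
  have hpow := hW.pow_lt G S
  have hpow' := hpow
  obtain ⟨μ, hmark, h1, h2⟩ := runs_mark (ρ := ρ) hW h
  have hsub : cull G k S ⊆ S := fun v hv => (Finset.mem_filter.1 hv).1
  set M := 2 * edgesIn G S with hMdef
  have hMq : M < 2 ^ Nat.clog 2 (M + 1) := Nat.le_pow_clog (by simp) (M + 1)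
  have hclog := Nat.two_pow_clog_lt (N := M + 1) (by omega)
  set q := Nat.clog 2 (M + 1)
  rw [pow_succ] at hpow'
  obtain ⟨F, hFdef⟩ : ∃ F : ℕ → Prop,
      ∀ j, F j ↔ j < M ∧ μ (2, μ (4, j)) = 0 ∧ μ (2, μ (1, j)) = 0 := ⟨_, fun _ => Iff.rfl⟩
  obtain ⟨t, hscan, h3, h4, h5, h6⟩ := runs_scan (ρ := ρ) (s := ⟨s.reg, μ⟩) hM hq hMq hpow F
    hFdef
  have arcs := h.arcs
  rw [hM] at arcs
  have hF : ∀ j < M, ∀ u v : Fin n, s.mem (4, j) = u → s.mem (1, j) = v →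
      (F j ↔ u ∈ cull G k S ∧ v ∈ cull G k S) := by
    intro j hj u v hu hv
    simp [hFdef, hj, h2 (4, j) (by simp), h2 (1, j) (by simp), hu, hv, h1]
  have r4 : t.reg 4 = M := (h3 4 (by simp)).trans hM
  have r5 : t.reg 5 = 2 ^ q := (h3 5 (by simp)).trans hq
  have hread : ∀ A, A ≠ 2 → A < 7 → ∀ j, t.mem (A, j) = s.mem (A, j) := fun A hA hA' j =>
    (h4 _ hA').trans (h2 _ hA)
  have e1 : ∀ j ≤ M, (2 ^ q + j) % W = 2 ^ q + j := fun j hj => Nat.mod_eq_of_lt (by omega)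
  have hst : ∀ j < M, s.mem (5, j) ≤ M := fun j hj => (arcs.st_le hj).trans hj.le
  have hen : ∀ j < M, s.mem (6, j) ≤ M := arcs.en_le
  obtain ⟨μ₁, run₁, new₁, old₁⟩ := runs_compact (ρ := ρ) (s := t) (A := 4) (F := F)
    (e := .get 4 (.reg 8)) (g := fun j => s.mem (4, j)) r4 r5 hMq hpow h5 h6 (by simp)
    (by simp [Exp.arrays]) (fun j _ _ => by
      simp [Exp.eval, State.thread, hread])
  have keep₁ : ∀ A, A ≠ 4 → A ≠ 9 → ∀ j, μ₁ (A, j) = t.mem (A, j) :=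
    fun A h h₉ j => old₁ _ h h₉
  obtain ⟨μ₂, run₂, new₂, old₂⟩ := runs_compact (ρ := ρ) (s := ⟨t.reg, μ₁⟩) (A := 1) (F := F)
    (e := .get 1 (.reg 8)) (g := fun j => s.mem (1, j)) r4 r5 hMq hpow
    (by simpa [keep₁] using h5) (by simpa [keep₁] using h6) (by simp)
    (by simp [Exp.arrays]) (fun j _ _ => by
      simp [Exp.eval, State.thread, keep₁, hread])
  have keep₂ : ∀ A, A ≠ 4 → A ≠ 1 → A ≠ 9 → ∀ j, μ₂ (A, j) = t.mem (A, j) :=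
    fun A h h₁ h₉ j => (old₂ _ h₁ h₉).trans (keep₁ A h h₉ j)
  obtain ⟨μ₃, run₃, new₃, old₃⟩ := runs_compact (ρ := ρ) (s := ⟨t.reg, μ₂⟩) (A := 5) (F := F)
    (e := .get 8 (.op .add (.reg 5) (.get 5 (.reg 8))))
    (g := fun j => Nat.count F (s.mem (5, j))) r4 r5 hMq hpow
    (by simpa [keep₂] using h5) (by simpa [keep₂] using h6) (by simp)
    (by simp [Exp.arrays]) (fun j hj _ => by
      simp [Exp.eval, Op.apply, State.thread, keep₂, hread, r5, e1 _ (hst j hj), h6 _ (hst j hj)])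
  have keep₃ : ∀ A, A ≠ 4 → A ≠ 1 → A ≠ 5 → A ≠ 9 → ∀ j, μ₃ (A, j) = t.mem (A, j) :=
    fun A h h₁ h₅ h₉ j => (old₃ _ h₅ h₉).trans (keep₂ A h h₁ h₉ j)
  obtain ⟨μ₄, run₄, new₄, old₄⟩ := runs_compact (ρ := ρ) (s := ⟨t.reg, μ₃⟩) (A := 6) (F := F)
    (e := .get 8 (.op .add (.reg 5) (.get 6 (.reg 8))))
    (g := fun j => Nat.count F (s.mem (6, j))) r4 r5 hMq hpow
    (by simpa [keep₃] using h5) (by simpa [keep₃] using h6) (by simp)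
    (by simp [Exp.arrays]) (fun j hj _ => by
      simp [Exp.eval, Op.apply, State.thread, keep₃, hread, r5, e1 _ (hen j hj), h6 _ (hen j hj)])
  have keep₄ : ∀ A, A ≠ 4 → A ≠ 1 → A ≠ 5 → A ≠ 6 → A ≠ 9 → ∀ j, μ₄ (A, j) = t.mem (A, j) :=
    fun A h h₁ h₅ h₆ h₉ j => (old₄ _ h₆ h₉).trans (keep₃ A h h₁ h₅ h₉ j)
  have hset := Runs.set (W := W) (ρ := ρ) 4 (e := .get 8 (.op .add (.reg 5) (.reg 4)))
    (s := ⟨t.reg, μ₄⟩) (v := Nat.count F M) (by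
      simp [Exp.eval, Op.apply, r4, r5, e1 _ le_rfl, keep₄, h6])
  refine ⟨_, (hmark.seq (hscan.seq (run₁.seq (run₂.seq (run₃.seq (run₄.seq hset)))))).mono ?_ ?_,
    ⟨?_, ?_, ?_, ?_, ?_⟩, ?_⟩
  · simp only [Exp.size]
    omega
  · simp only [Exp.size]
    omega
  · simp [h3, h.reg_zero]
  · simp [h3, h.reg_three]
  · simp only [Function.update_self]
    refine arcs.compact hsub hF (fun j hj hj' => ?_) (fun j hj hj' => ?_) (fun j hj hj' => ?_)
      new₄
    · rw [old₄ _ (by simp) (by simp)]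
      exact (old₃ _ (by simp) (by simp)).trans
        ((old₂ _ (by simp) (by simp)).trans (new₁ j hj hj'))
    · rw [old₄ _ (by simp) (by simp)]
      exact (old₃ _ (by simp) (by simp)).trans (new₂ j hj hj')
    · exact (old₄ _ (by simp) (by simp)).trans (new₃ j hj hj')
  · intro v
    simp [keep₄, h4, h1]
  · intro v
    simp [keep₄, h4, h2, h.label]
  · simp [h3]

end CulledPartition

/-! ### The main loop, the initialisation and the cost of the whole program. -/

namespace CulledPartition

open ParRAM

variable {W : ℕ} {ρ : ℕ → ℕ} {n k : ℕ} {G : SimpleGraph (Fin n)} {ω : Fin n → Fin k}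
  {S : Finset (Fin n)} {s : State}

/-- The body of the main loop. -/
def stageOneBody : Prog :=
  .seq check (.ite (.get 7 (.lit 1)) round (.set 6 (.lit 0)))

theorem WordBound.one_mod (hW : WordBound n k W) : 1 % W = 1 := by
  have h1 := hW.sq
  have h2 : 2 * 2 ≤ n * n := Nat.mul_le_mul hW.two_le hW.two_le
  exact Nat.mod_eq_of_lt (by omega)

theorem runs_stageOne_halt (hW : WordBound n k W) (h : Represents G ω S s)
    (hhalt : ¬ ∃ v ∈ S, threshold G k S < degIn G S v) (h6 : s.reg 6 = 1) :
    ∃ t, Runs W ρ (.loop (.reg 6) stageOneBody) s t (900 * (2 * edgesIn G S + 1))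
      (500 * (Nat.clog 2 (2 * edgesIn G S + 1) + 1)) ∧ Represents G ω S t := by
  obtain ⟨t, hrun, h1, -, -, h2⟩ := runs_check (ρ := ρ) hW h
  have hset := Runs.set (W := W) (ρ := ρ) 6 (e := .lit 0) (s := t) (v := 0) (by simp [Exp.eval])
  have hite := Runs.iteFalse (W := W) (ρ := ρ) (e := .get 7 (.lit 1)) (c := round)
    (by
      simp only [Exp.eval, hW.one_mod]
      by_contra hne
      exact hhalt (h2.1 hne)) hset
  refine ⟨_, (Runs.loopStep (by simp [Exp.eval, h6]) (hrun.seq hite)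
    (Runs.loopDone (by simp [Exp.eval]))).mono ?_ ?_, h1.congr (by simp) (by simp) (by simp)
      fun _ _ => rfl⟩
  · simp only [Exp.size]
    omega
  · simp only [Exp.size]
    omega

theorem runs_stageOneBody (hW : WordBound n k W) (h : Represents G ω S s)
    (hstep : ∃ v ∈ S, threshold G k S < degIn G S v) (h6 : s.reg 6 = 1) :
    ∃ t, Runs W ρ stageOneBody s t (890 * (2 * edgesIn G S + 1))
      (490 * (Nat.clog 2 (2 * edgesIn G S + 1) + 1)) ∧ Represents G ω (cull G k S) t ∧
      t.reg 6 = 1 := by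
  obtain ⟨t, hrun, h1, h2, h3, h4⟩ := runs_check (ρ := ρ) hW h
  obtain ⟨u, hrun', h5, h7⟩ := runs_round (ρ := ρ) hW h1 h3
  have hite := Runs.iteTrue (W := W) (ρ := ρ) (e := .get 7 (.lit 1)) (c' := .set 6 (.lit 0))
    (by
      simp only [Exp.eval, hW.one_mod]
      exact h4.2 hstep) hrun'
  refine ⟨u, (hrun.seq hite).mono ?_ ?_, h5, (h7.trans h2).trans h6⟩
  · simp only [Exp.size]
    omega
  · simp only [Exp.size]
    omega

/-- Work follows a geometric series, since the arc count halves. Depth is one tree height, uniformly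
bounded through `H`, per unit of the potential `log e + 2`; the `2` covers a last round without
halving and the final test. -/
theorem runs_stageOne_loop (hW : WordBound n k W) (H : ℕ) (S : Finset (Fin n)) :
    Nat.clog 2 (2 * edgesIn G S + 1) ≤ H → ∀ s, Represents G ω S s → s.reg 6 = 1 →
    ∃ t, Runs W ρ (.loop (.reg 6) stageOneBody) s t (2700 * (2 * edgesIn G S + 1))
      (500 * (H + 1) * (Nat.log 2 (edgesIn G S) + 2)) ∧ Represents G ω (survivors G k S) t := by
  induction S using survivors_induction (G := G) (k := k) with
  | halt S hhalt =>
    intro hH s h h6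
    obtain ⟨t, hrun, h1⟩ := runs_stageOne_halt (ρ := ρ) hW h hhalt h6
    refine ⟨t, hrun.mono (by omega) ?_, by rwa [survivors_of_not_exists G k S hhalt]⟩
    calc _ ≤ 500 * (H + 1) * 1 := by omega
      _ ≤ _ := Nat.mul_le_mul_left _ (by omega)
  | step S hstep ih =>
    intro hH s h h6
    obtain ⟨t, hrun, h1, h2⟩ := runs_stageOneBody (ρ := ρ) hW h hstep h6
    have hle : edgesIn G (cull G k S) ≤ edgesIn G S :=
      edgesIn_mono G fun v hv => (Finset.mem_filter.1 hv).1
    have hH' : Nat.clog 2 (2 * edgesIn G (cull G k S) + 1) ≤ H :=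
      (Nat.clog_mono_right 2 (by omega)).trans hH
    rw [survivors_of_exists G k S hstep]
    by_cases hc : ∃ v ∈ cull G k S, threshold G k (cull G k S) < degIn G (cull G k S) v
    · obtain ⟨u, hrun', h3⟩ := ih hH' t h1 h2
      -- Halving gives `2 e' + 1 ≤ e`, so the bound for the rest of the loop is at most half of the
      -- claimed one.
      have h4 := two_mul_edgesIn_cull_lt G k S hc
      have h5 := log_edgesIn_cull_lt G k S hc
      refine ⟨u, (Runs.loopStep (by simp [Exp.eval, h6]) hrun hrun').mono ?_ ?_, h3⟩
      · simp only [Exp.size]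
        omega
      · simp only [Exp.size]
        calc _ ≤ 500 * (H + 1) + 500 * (H + 1) * (Nat.log 2 (edgesIn G (cull G k S)) + 2) := by
              omega
          _ = 500 * (H + 1) * (Nat.log 2 (edgesIn G (cull G k S)) + 3) := by ring
          _ ≤ _ := Nat.mul_le_mul_left _ (by omega)
    · obtain ⟨u, hrun', h3⟩ := runs_stageOne_halt (ρ := ρ) hW h1 hc h2
      refine ⟨u, (Runs.loopStep (by simp [Exp.eval, h6]) hrun hrun').mono ?_ ?_,
        by rwa [survivors_of_not_exists G k _ hc]⟩
      · simp only [Exp.size]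
        omega
      · simp only [Exp.size]
        calc _ ≤ 500 * (H + 1) * 2 := by omega
          _ ≤ _ := Nat.mul_le_mul_left _ (by omega)

/-- Writes the source of every arc to array `4`. -/
def writeSources : Prog :=
  .fork 8 (.reg 0)
    (scatter 9 (.op .sub (.get 0 (.op .add (.reg 8) (.lit 1))) (.get 0 (.reg 8))) (.lit 1) 4
      (.op .add (.get 0 (.reg 8)) (.reg 9)) (.reg 8))

/-- One thread per vertex forks one thread per incident arc: constant depth whatever the degrees,
with work adding up to the number of vertices plus arcs. Outer threads write to disjoint segments of
array `4` and read only array `0`. -/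
theorem runs_writeSources {off adj : ℕ → ℕ} (hadj : IsAdjacencyArray G off adj)
    (h0 : s.reg 0 = n) (hoff : ∀ v ≤ n, s.mem (0, v) = off v) (hoffW : off n < W)
    (hnW : n < W) (h1W : 1 < W) :
    ∃ μ, Runs W ρ writeSources s ⟨s.reg, μ⟩ (40 * (n + off n + 1)) 40 ∧
      (∀ v < n, ∀ j, off v ≤ j → j < off (v + 1) → μ (4, j) = v) ∧
      ∀ l, l.1 ≠ 4 → μ l = s.mem l := by
  have c1 : 1 % W = 1 := Nat.mod_eq_of_lt h1W
  have key : ∀ v, ∃ t p, v < n → Exec W ρ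
      (scatter 9 (.op .sub (.get 0 (.op .add (.reg 8) (.lit 1))) (.get 0 (.reg 8))) (.lit 1) 4
        (.op .add (.get 0 (.reg 8)) (.reg 9)) (.reg 8)) (s.thread 8 v) t p ∧
      p.work ≤ 18 + (off (v + 1) - off v) * 10 ∧ p.depth ≤ 30 ∧ (∀ l ∈ p.reads, l.1 = 0) ∧
      (∀ l, l ∈ p.writes ↔ l.1 = 4 ∧ off v ≤ l.2 ∧ l.2 < off (v + 1)) ∧
      ∀ j, off v ≤ j → j < off (v + 1) → t.mem (4, j) = v := by
    intro v
    by_cases hv : v < n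
    · have m1 : off v ≤ off (v + 1) := hadj.off_le ⟨v, hv⟩
      have m2 : off (v + 1) ≤ off n := hadj.off_mono hv le_rfl
      have e1 : (v + 1) % W = v + 1 := Nat.mod_eq_of_lt (by omega)
      obtain ⟨μ, p, hex, hw, hd, hr, hwr, h1, h2⟩ := Exec.exists_scatter (W := W) (ρ := ρ) (x := 9)
        (A := 4) (s := s.thread 8 v) (N := off (v + 1) - off v)
        (eN := .op .sub (.get 0 (.op .add (.reg 8) (.lit 1))) (.get 0 (.reg 8))) (b := .lit 1)
        (idx := .op .add (.get 0 (.reg 8)) (.reg 9)) (e := .reg 8)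
        (by simp [Exp.eval, Op.apply, State.thread, c1, e1, hoff v hv.le, hoff (v + 1) hv])
        (fun _ => True) (fun i => off v + i) (fun _ => v)
        (fun i _ => by simp [Exp.eval, c1])
        (fun i hi _ => by
          simp [Exp.eval, Op.apply, State.thread, hoff v hv.le]
          exact Nat.mod_eq_of_lt (by omega))
        (fun i _ _ => by simp [Exp.eval, State.thread])
        (fun i _ j _ _ _ hij => by simpa using hij)
        (fun i _ j _ _ _ => by simp [Exp.reads])
      refine ⟨_, p, fun _ => ⟨hex, ?_, ?_, ?_, ?_, ?_⟩⟩
      · simp only [Exp.size] at hw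
        omega
      · simp only [Exp.size] at hd
        omega
      · intro l hl
        rcases hr hl with hl | ⟨j, -, hl | hl | hl⟩ <;>
          simpa [Exp.arrays] using Exp.fst_mem_arrays hl
      · rintro ⟨A, j⟩
        rw [hwr]
        simp only [true_and, Prod.mk.injEq]
        constructor
        · rintro ⟨i, hi, rfl, rfl⟩
          omega
        · rintro ⟨rfl, h3, h4⟩
          exact ⟨j - off v, by omega, rfl, by omega⟩
      · intro j h3 h4
        have := h1 (j - off v) (by omega) trivial
        rwa [Nat.add_sub_cancel' h3] at this
    · exact ⟨s, ⟨0, 0, ∅, ∅⟩, fun h => absurd h hv⟩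
  choose t p hp using key
  have hrace : RaceFree n p := by
    intro u hu v hv huv
    refine Set.disjoint_left.2 fun l hl hl' => ?_
    have h1 := ((hp u hu).2.2.2.2.1 l).1 hl
    rcases hl' with hl' | hl'
    · have := (hp v hv).2.2.2.1 l hl'
      omega
    · have h2 := ((hp v hv).2.2.2.2.1 l).1 hl'
      exact huv (hadj.segment_unique hu hv h1.2.1 h1.2.2 h2.2.1 h2.2.2)
  obtain ⟨μ, hex, h1, h2⟩ := Exec.exists_fork (e := .reg 0) (by simpa [Exp.eval] using h0) t p
    (fun v hv => (hp v hv).1) hrace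
  -- The sum telescopes despite truncated subtraction because `off` is monotone up to `n`.
  have htel : ∀ m ≤ n, ∑ v ∈ Finset.range m, (off (v + 1) - off v) = off m := by
    intro m hm
    induction m with
    | zero => simp [hadj.off_zero]
    | succ m ih =>
      have : off m ≤ off (m + 1) := hadj.off_le ⟨m, hm⟩
      rw [Finset.sum_range_succ, ih (by omega)]
      omega
  refine ⟨μ, ⟨_, hex, ?_, ?_⟩, ?_, ?_⟩
  · have : (Cost.par n p).work ≤ ∑ v ∈ Finset.range n, (19 + (off (v + 1) - off v) * 10) := by
      change ∑ i ∈ Finset.range n, ((p i).work + 1) ≤ _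
      refine Finset.sum_le_sum fun v hv => ?_
      have := (hp v (Finset.mem_range.1 hv)).2.1
      omega
    rw [Finset.sum_add_distrib, ← Finset.sum_mul, htel n le_rfl] at this
    simp only [Finset.sum_const, Finset.card_range, smul_eq_mul] at this
    simp only [Cost.andThen, stepCost, Exp.size]
    omega
  · have : (Cost.par n p).depth ≤ 31 := Cost.par_depth_le fun v hv => (hp v hv).2.2.1
    simp only [Cost.andThen, stepCost, Exp.size]
    omega
  · intro v hv j h3 h4
    rw [h1 v hv (4, j) (((hp v hv).2.2.2.2.1 _).2 ⟨rfl, h3, h4⟩)]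
    exact (hp v hv).2.2.2.2.2 j h3 h4
  · intro l hl
    exact h2 l fun v hv h3 => hl (((hp v hv).2.2.2.2.1 l).1 h3).1

/-- Computes the constants and the list of all arcs, and draws the labels. -/
def prepare : Prog :=
  .seq (doubling 2 (.reg 0))
    (.seq (.set 3 (.op .mul (.op .mul (.lit 2) (.op .mul (.op .mul (.reg 1) (.reg 1))
        (.op .mul (.reg 1) (.reg 1)))) (.reg 2)))
      (.seq (.set 4 (.get 0 (.reg 0)))
        (.seq (scatter 8 (.reg 0) (.lit 1) 3 (.reg 8) (.rand (.reg 8)))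
          (.seq writeSources
            (.seq (scatter 8 (.reg 4) (.lit 1) 5 (.reg 8) (.get 0 (.get 4 (.reg 8))))
              (.seq (scatter 8 (.reg 4) (.lit 1) 6 (.reg 8)
                (.get 0 (.op .add (.get 4 (.reg 8)) (.lit 1))))
                (.set 6 (.lit 1))))))))

theorem runs_prepare (hW : WordBound n k W) {off adj : ℕ → ℕ}
    (hadj : IsAdjacencyArray G off adj) :
    ∃ t, Runs W (tape ω) prepare (input n k off adj) t (200 * (n + off n + 1))
        (200 * (Nat.clog 2 n + 1)) ∧ Represents G ω Finset.univ t ∧ t.reg 6 = 1 := by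
  have hn := hW.two_le
  have hk := hW.one_le
  have hsq := hW.sq
  have hsq' : 2 * n ≤ n * n := Nat.mul_le_mul_right n hn
  have c1 := hW.one_mod
  have c2 : 2 % W = 2 := Nat.mod_eq_of_lt (by omega)
  have hL : 0 < Nat.clog 2 n := Nat.clog_pos (by simp) hn
  have hoffn : off n < n * n := by
    rw [hadj.off_last]
    exact hW.length_lt G _
  have hclog : Nat.clog 2 n ≤ n := by
    rw [Nat.clog_le_iff_le_pow (by simp)]
    exact Nat.lt_two_pow_self.le
  set s₀ := input n k off adj with hs₀
  have hdouble := runs_doubling (W := W) (ρ := tape ω) (c := 2) (N := n) (e := .reg 0) (by simp)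
    (by omega) (by omega) s₀ (fun p i => by simp [Exp.eval, s₀, input])
  set r₁ := Function.update (Function.update s₀.reg 5 (2 ^ Nat.clog 2 n)) 2 (Nat.clog 2 n) with hr₁
  set Q := 2 * k ^ 4 * Nat.clog 2 n with hQ
  have hQW : Q < W := by
    refine lt_of_le_of_lt ?_ hW.scaled
    rw [← hQ, ← mul_assoc]
    exact Nat.le_mul_of_pos_left _ (by omega)
  have hset := Runs.set (W := W) (ρ := tape ω) 3 (e := .op .mul (.op .mul (.lit 2)
      (.op .mul (.op .mul (.reg 1) (.reg 1)) (.op .mul (.reg 1) (.reg 1)))) (.reg 2))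
    (s := ⟨r₁, s₀.mem⟩) (v := Q) (by
      -- Every intermediate product is at most `Q < W`, so none of the multiplications wraps around.
      have k4 : 2 * k ^ 4 ≤ Q := Nat.le_mul_of_pos_right _ hL
      have k2 : k * k ≤ k ^ 4 := by
        calc k * k = k ^ 2 := (sq k).symm
          _ ≤ k ^ 4 := Nat.pow_le_pow_right hk (by simp)
      have k44 : k * k * (k * k) = k ^ 4 := by ring
      simp [Exp.eval, Op.apply, r₁, s₀, input, c2, Nat.mod_eq_of_lt (show k * k < W by omega), k44,
        Nat.mod_eq_of_lt (show k ^ 4 < W by omega), Nat.mod_eq_of_lt (show 2 * k ^ 4 < W by omega)]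
      exact Nat.mod_eq_of_lt hQW)
  have hset' := Runs.set (W := W) (ρ := tape ω) 4 (e := .get 0 (.reg 0))
    (s := ⟨Function.update r₁ 3 Q, s₀.mem⟩) (v := off n) (by
      simp [Exp.eval, r₁, s₀, input])
  set r := Function.update (Function.update r₁ 3 Q) 4 (off n) with hr
  have reg0 : r 0 = n := by simp [r, r₁, s₀, input]
  have reg4 : r 4 = off n := by simp [r]
  obtain ⟨μ₁, run₁, new₁, old₁⟩ := Runs.exists_scatter_of_notMem (W := W) (ρ := tape ω) (x := 8)
    (A := 3) (s := ⟨r, s₀.mem⟩) (N := n) (eN := .reg 0) (b := .lit 1) (idx := .reg 8)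
    (e := .rand (.reg 8)) reg0 (fun _ => True) (fun i => i) (fun i => tape ω i)
    (by simp [Exp.arrays]) (fun i _ => by simp [Exp.eval, c1])
    (fun i _ _ => by simp [Exp.eval, State.thread])
    (fun i _ _ => by simp [Exp.eval, State.thread]) (fun i _ j _ _ _ hij => hij)
  have keep₁ : ∀ A, A ≠ 3 → ∀ j, μ₁ (A, j) = s₀.mem (A, j) := fun A hA j =>
    old₁ _ fun i _ _ h => hA (Prod.ext_iff.1 h).1
  have hoff : ∀ v ≤ n, s₀.mem (0, v) = off v := fun v hv => by simp [s₀, input, hv]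
  obtain ⟨μ₂, run₂, new₂, old₂⟩ := runs_writeSources (W := W) (ρ := tape ω) (s := ⟨r, μ₁⟩) hadj reg0
    (fun v hv => (keep₁ 0 (by simp) v).trans (hoff v hv)) (by omega) (by omega) (by omega)
  have keep₂ : ∀ A, A ≠ 3 → A ≠ 4 → ∀ j, μ₂ (A, j) = s₀.mem (A, j) := fun A h₃ h₄ j =>
    (old₂ _ h₄).trans (keep₁ A h₃ j)
  have hsrc : ∀ j < off n, μ₂ (4, j) < n := by
    intro j hj
    obtain ⟨v, hv, h1, h2⟩ := hadj.exists_segment le_rfl hj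
    rwa [new₂ v hv j h1 h2]
  obtain ⟨μ₃, run₃, new₃, old₃⟩ := Runs.exists_scatter_of_notMem (W := W) (ρ := tape ω) (x := 8)
    (A := 5) (s := ⟨r, μ₂⟩) (N := off n) (eN := .reg 4) (b := .lit 1) (idx := .reg 8)
    (e := .get 0 (.get 4 (.reg 8))) reg4 (fun _ => True) (fun i => i) (fun i => off (μ₂ (4, i)))
    (by simp [Exp.arrays]) (fun i _ => by simp [Exp.eval, c1])
    (fun i _ _ => by simp [Exp.eval, State.thread])
    (fun i hi _ => by simp [Exp.eval, State.thread, keep₂, hoff _ (hsrc i hi).le])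
    (fun i _ j _ _ _ hij => hij)
  have keep₃ : ∀ A, A ≠ 5 → ∀ j, μ₃ (A, j) = μ₂ (A, j) := fun A hA j =>
    old₃ _ fun i _ _ h => hA (Prod.ext_iff.1 h).1
  obtain ⟨μ₄, run₄, new₄, old₄⟩ := Runs.exists_scatter_of_notMem (W := W) (ρ := tape ω) (x := 8)
    (A := 6) (s := ⟨r, μ₃⟩) (N := off n) (eN := .reg 4) (b := .lit 1) (idx := .reg 8)
    (e := .get 0 (.op .add (.get 4 (.reg 8)) (.lit 1))) reg4 (fun _ => True) (fun i => i)
    (fun i => off (μ₂ (4, i) + 1))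
    (by simp [Exp.arrays]) (fun i _ => by simp [Exp.eval, c1])
    (fun i _ _ => by simp [Exp.eval, State.thread])
    (fun i hi _ => by
      have := hsrc i hi
      simp [Exp.eval, Op.apply, State.thread, keep₃, keep₂, c1,
        Nat.mod_eq_of_lt (show μ₂ (4, i) + 1 < W by omega), hoff _ this])
    (fun i _ j _ _ _ hij => hij)
  have keep₄ : ∀ A, A ≠ 6 → ∀ j, μ₄ (A, j) = μ₃ (A, j) := fun A hA j =>
    old₄ _ fun i _ _ h => hA (Prod.ext_iff.1 h).1
  have hset6 := Runs.set (W := W) (ρ := tape ω) 6 (e := .lit 1) (s := ⟨r, μ₄⟩) (v := 1)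
    (by simp [Exp.eval, c1])
  refine ⟨_, (hdouble.seq (hset.seq (hset'.seq (run₁.seq
    (run₂.seq (run₃.seq (run₄.seq hset6))))))).mono ?_ ?_, ⟨?_, ?_, ?_, ?_, ?_⟩, ?_⟩
  · simp only [Exp.size]
    omega
  · simp only [Exp.size]
    omega
  · simpa using reg0
  · simp [r, Q]
  · simp only [ne_eq, Nat.reduceEqDiff, not_false_eq_true, Function.update_of_ne, reg4]
    refine hadj.isArcList (fun v hv j h1 h2 => ?_) (fun j hj => ?_) (fun j hj => ?_) fun j hj => ?_
    · simpa [keep₄, keep₃] using new₂ v hv j h1 h2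
    · simp [keep₄, keep₃, keep₂, s₀, input, hj]
    · simpa [keep₄, keep₃] using new₃ j hj trivial
    · simpa [keep₄, keep₃] using new₄ j hj trivial
  · intro v
    simp [keep₄, keep₃, keep₂, s₀, input]
  · intro v
    have := new₁ v v.2 trivial
    simp [keep₄, keep₃, old₂, this, tape]
  · simp

/-- The algorithm. -/
def algorithm : Prog :=
  .seq prepare (.loop (.reg 6) stageOneBody)

theorem clog_le_of_lt_sq {M : ℕ} (h : M < n * n) : Nat.clog 2 (M + 1) ≤ 2 * Nat.clog 2 n := by
  rw [Nat.clog_le_iff_le_pow (by simp), mul_comm, pow_mul, sq]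
  have := Nat.le_pow_clog (b := 2) (by simp) n
  exact Nat.succ_le_of_lt (h.trans_le (Nat.mul_le_mul this this))

theorem log_edgesIn_le (hn : 0 < n) (G : SimpleGraph (Fin n)) (S : Finset (Fin n)) :
    Nat.log 2 (edgesIn G S) ≤ 2 * Nat.clog 2 n := by
  have h1 : 2 * edgesIn G S < n * n := by simpa using two_mul_edgesIn_lt G S (by simpa using hn)
  calc Nat.log 2 (edgesIn G S) ≤ Nat.clog 2 (edgesIn G S) := Nat.log_le_clog _ _
    _ ≤ Nat.clog 2 (2 * edgesIn G S + 1) := Nat.clog_mono_right 2 (by omega)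
    _ ≤ _ := clog_le_of_lt_sq h1

theorem exec_algorithm (hW : WordBound n k W) {off adj : ℕ → ℕ}
    (hadj : IsAdjacencyArray G off adj) :
    ∃ t p, Exec W (tape ω) algorithm (input n k off adj) t p ∧
      outCulled n t = culledSet G k ∧ (∀ i, outBucket n k t i = bucket G k ω i) ∧
      p.work ≤ 6000 * (n + G.edgeSet.ncard) ∧
      p.depth ≤ 20000 * Nat.clog 2 n ^ 2 := by
  obtain ⟨s, hrun, h1, h2⟩ := runs_prepare (ω := ω) hW hadj
  have hlt := hW.length_lt G Finset.univ
  have hn := hW.two_le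
  have hH := clog_le_of_lt_sq hlt
  obtain ⟨t, hrun', h3⟩ := runs_stageOne_loop (ρ := tape ω) hW _ Finset.univ hH s h1 h2
  obtain ⟨p, hex, hw, hd⟩ := hrun.seq hrun'
  refine ⟨t, p, hex, ?_, ?_, ?_, ?_⟩
  · ext v
    simp [outCulled, culledSet, h3.culled]
  · intro i
    ext v
    simp [outBucket, bucket, culledSet, h3.culled, h3.label, Fin.val_inj]
  · rw [hadj.off_last] at hw
    rw [← edgesIn_univ]
    omega
  · have hL : 0 < Nat.clog 2 n := Nat.clog_pos (by simp) hn
    have hlog := log_edgesIn_le (by omega) G Finset.univ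
    refine hd.trans ?_
    -- Both the tree height and the logarithm of the edge count are at most `2 * Nat.clog 2 n`,
    -- because there are fewer than `n²` arcs.
    calc _ ≤ 200 * (Nat.clog 2 n + 1) +
          500 * (2 * Nat.clog 2 n + 1) * (2 * Nat.clog 2 n + 2) := by gcongr
      _ ≤ _ := by nlinarith

end CulledPartition

/-! ### The bounded differences inequality for uniform arguments. -/

section BoundedDifferences

open Real

/-- Hoeffding's lemma for the uniform distribution on a finite type. -/
theorem sum_exp_le_of_abs_sub_le {α : Type*} [Fintype α] [Nonempty α] {X : α → ℝ} {c : ℝ}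
    (h : ∀ i j, |X i - X j| ≤ c) (s : ℝ) :
    ∑ i, exp (s * X i) ≤
      Fintype.card α * exp (s * ((∑ i, X i) / Fintype.card α) + s ^ 2 * c ^ 2 / 2) := by
  set N : ℝ := (Fintype.card α : ℝ) with hN
  have hNpos : 0 < N := by
    rw [hN]
    exact_mod_cast Fintype.card_pos
  set m := (∑ i, X i) / N with hm
  have hsum : ∑ i, (X i - m) = 0 := by
    rw [Finset.sum_sub_distrib, Finset.sum_const, Finset.card_univ, nsmul_eq_mul, ← hN, hm]
    field_simp
    ring
  have hY : ∀ i, |X i - m| ≤ c := by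
    intro i
    have h1 : X i - m = (∑ j, (X i - X j)) / N := by
      rw [Finset.sum_sub_distrib, Finset.sum_const, Finset.card_univ, nsmul_eq_mul, ← hN, hm]
      field_simp
    rw [h1, abs_div, abs_of_pos hNpos, div_le_iff₀ hNpos]
    refine (Finset.abs_sum_le_sum_abs _ _).trans ((Finset.sum_le_sum fun j _ => h i j).trans ?_)
    rw [Finset.sum_const, Finset.card_univ, nsmul_eq_mul, ← hN, mul_comm]
  -- This is the chord of `exp` over `[-s c, s c]`; its linear term vanishes on summation by `hsum`.
  -- For `c = 0` the deviation is zero and the bound is trivial.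
  have hexp : ∀ i, exp (s * (X i - m)) ≤ cosh (s * c) + (X i - m) * (sinh (s * c) / c) := by
    intro i
    have h1 := abs_le.1 (hY i)
    rcases (abs_nonneg _).trans (hY i) |>.eq_or_lt with hc | hc
    · have : X i - m = 0 := by rw [← hc] at h1; linarith
      simp [this, ← hc]
    · have h2 := @convexOn_exp.2 (-(s * c)) trivial (s * c) trivial
        ((c - (X i - m)) / (2 * c)) ((c + (X i - m)) / (2 * c))
        (div_nonneg (by linarith) (by linarith)) (div_nonneg (by linarith) (by linarith))
        (by field_simp; ring)
      have h3 : (c - (X i - m)) / (2 * c) * -(s * c) + (c + (X i - m)) / (2 * c) * (s * c)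
          = s * (X i - m) := by field_simp; ring
      simp only [smul_eq_mul, h3] at h2
      refine h2.trans (le_of_eq ?_)
      rw [cosh_eq, sinh_eq]
      field_simp
      ring
  have h4 : ∑ i, exp (s * (X i - m)) ≤ N * exp (s ^ 2 * c ^ 2 / 2) := by
    refine (Finset.sum_le_sum fun i _ => hexp i).trans ?_
    rw [Finset.sum_add_distrib, ← Finset.sum_mul, hsum, zero_mul, add_zero, Finset.sum_const,
      Finset.card_univ, nsmul_eq_mul, ← hN, ← mul_pow]
    exact mul_le_mul_of_nonneg_left (cosh_le_exp_half_sq _) hNpos.le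
  have h5 : ∀ i, exp (s * X i) = exp (s * m) * exp (s * (X i - m)) := fun i => by
    rw [← exp_add]
    ring_nf
  simp only [h5, ← Finset.mul_sum]
  rw [exp_add]
  calc _ ≤ exp (s * m) * (N * exp (s ^ 2 * c ^ 2 / 2)) :=
        mul_le_mul_of_nonneg_left h4 (exp_pos _).le
    _ = _ := by ring

/-- The exponential moments of a function with bounded differences of independent and uniform
arguments. -/
theorem sum_exp_le_of_boundedDifferences {α : Type*} [Fintype α] [Nonempty α] (s : ℝ) {n : ℕ}
    {f : (Fin n → α) → ℝ} {c : Fin n → ℝ}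
    (h : ∀ ω v x, |f ω - f (Function.update ω v x)| ≤ c v) :
    ∑ ω, exp (s * f ω) ≤ (Fintype.card α : ℝ) ^ n *
      exp (s * ((∑ ω, f ω) / (Fintype.card α : ℝ) ^ n) + s ^ 2 * (∑ v, c v ^ 2) / 2) := by
  induction n with
  | zero => simp
  | succ n ih =>
    set N : ℝ := (Fintype.card α : ℝ) with hN
    have hNpos : 0 < N := by
      rw [hN]
      exact_mod_cast Fintype.card_pos
    -- Averaging out the first coordinate keeps the mean and the bounds for the other coordinates.
    -- Hoeffding's lemma in the first coordinate contributes `c 0`, and induction handles `g`.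
    let g : (Fin n → α) → ℝ := fun y => (∑ x, f (Fin.cons x y)) / N
    have hsplit : ∀ F : (Fin (n + 1) → α) → ℝ, ∑ ω, F ω = ∑ y, ∑ x, F (Fin.cons x y) := by
      intro F
      rw [Finset.sum_comm, ← Fintype.sum_prod_type', ← (Fin.consEquiv fun _ => α).sum_comp]
      rfl
    have hg : ∀ y v x, |g y - g (Function.update y v x)| ≤ c v.succ := by
      intro y v x
      have : g y - g (Function.update y v x) =
          (∑ z, (f (Fin.cons z y) - f (Fin.cons z (Function.update y v x)))) / N := by
        rw [Finset.sum_sub_distrib, sub_div]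
      rw [this, abs_div, abs_of_pos hNpos, div_le_iff₀ hNpos]
      refine (Finset.abs_sum_le_sum_abs _ _).trans
        ((Finset.sum_le_sum (g := fun _ => c v.succ) fun z _ => ?_).trans ?_)
      · rw [Fin.cons_update]
        exact h _ _ _
      · rw [Finset.sum_const, Finset.card_univ, nsmul_eq_mul, ← hN, mul_comm]
    have hmean : (∑ y, g y) / N ^ n = (∑ ω, f ω) / N ^ (n + 1) := by
      rw [hsplit, ← Finset.sum_div, div_div, pow_succ, mul_comm N]
    have hone : ∀ y, ∑ x, exp (s * f (Fin.cons x y)) ≤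
        N * exp (s * g y + s ^ 2 * c 0 ^ 2 / 2) := by
      intro y
      refine sum_exp_le_of_abs_sub_le (fun i j => ?_) s
      have := h (Fin.cons i y) 0 j
      rwa [Fin.update_cons_zero] at this
    rw [hsplit]
    calc ∑ y, ∑ x, exp (s * f (Fin.cons x y))
        ≤ ∑ y, N * exp (s * g y + s ^ 2 * c 0 ^ 2 / 2) := Finset.sum_le_sum fun y _ => hone y
      _ = N * exp (s ^ 2 * c 0 ^ 2 / 2) * ∑ y, exp (s * g y) := by
          rw [Finset.mul_sum]
          refine Finset.sum_congr rfl fun y _ => ?_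
          rw [exp_add]
          ring
      _ ≤ N * exp (s ^ 2 * c 0 ^ 2 / 2) * (N ^ n * exp (s * ((∑ y, g y) / N ^ n) +
            s ^ 2 * (∑ v : Fin n, c v.succ ^ 2) / 2)) :=
          mul_le_mul_of_nonneg_left (ih hg) (by positivity)
      _ = _ := by
          rw [mul_mul_mul_comm, ← exp_add, ← pow_succ', hmean, Fin.sum_univ_succ]
          congr 2
          ring

end BoundedDifferences

/-! ### Concentration of the number of edges in a bucket. -/

namespace CulledPartition

open Real

variable {n k : ℕ} {G : SimpleGraph (Fin n)} {S : Finset (Fin n)}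

theorem bucket_eq_filter (G : SimpleGraph (Fin n)) (ω : Fin n → Fin k) (i : Fin k) :
    bucket G k ω i = {v ∈ survivors G k Finset.univ | ω v = i} := by
  ext v
  simp [bucket, culledSet]

/-- Compare degree sums: erasing `v` loses its own degree and one unit at each of its neighbours,
twice its degree altogether. -/
theorem edgesIn_le_erase {V : Type*} [DecidableEq V] (G : SimpleGraph V) (T : Finset V) (v : V) :
    edgesIn G T ≤ edgesIn G (T.erase v) + degIn G T v := by
  classical
  by_cases hv : v ∈ T
  · have h1 := sum_degIn G T
    have h2 := sum_degIn G (T.erase v)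
    rw [← Finset.add_sum_erase _ _ hv] at h1
    have h3 : ∀ u, degIn G T u ≤ degIn G (T.erase v) u + if G.Adj v u then 1 else 0 := by
      intro u
      have : ({w ∈ T | G.Adj u w} : Finset V) ⊆
          {w ∈ T.erase v | G.Adj u w} ∪ if G.Adj v u then {v} else ∅ := by
        intro w hw
        obtain ⟨hw1, hw2⟩ := Finset.mem_filter.1 hw
        by_cases hwv : w = v
        · subst hwv
          simp [hw2.symm]
        · exact Finset.mem_union_left _ (Finset.mem_filter.2 ⟨Finset.mem_erase.2 ⟨hwv, hw1⟩, hw2⟩)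
      refine (Finset.card_le_card this).trans ((Finset.card_union_le _ _).trans ?_)
      refine Nat.add_le_add (le_of_eq ?_) ?_
      · rw [degIn]
      · split_ifs <;> simp
    have h4 : ∑ u ∈ T.erase v, (if G.Adj v u then 1 else 0) ≤ degIn G T v := by
      rw [← Finset.card_filter, degIn]
      refine Finset.card_le_card fun u hu => ?_
      obtain ⟨hu1, hu2⟩ := Finset.mem_filter.1 hu
      exact Finset.mem_filter.2 ⟨Finset.mem_of_mem_erase hu1, hu2⟩
    have h5 := Finset.sum_le_sum fun u (_ : u ∈ T.erase v) => h3 u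
    rw [Finset.sum_add_distrib] at h5
    omega
  · rw [Finset.erase_eq_of_notMem hv]
    omega

/-- The influence of the label of `v` on the number of edges of a bucket. -/
theorem abs_edgesIn_filter_sub_le (G : SimpleGraph (Fin n)) (S : Finset (Fin n))
    (ω : Fin n → Fin k) (i : Fin k) (v : Fin n) (x : Fin k) :
    |(edgesIn G {u ∈ S | ω u = i} : ℝ) - edgesIn G {u ∈ S | Function.update ω v x u = i}| ≤
      if v ∈ S then (degIn G S v : ℝ) else 0 := by
  classical
  -- Once `v` is erased, the bucket of `ω` is contained in that of `ω'`.
  have key : ∀ ω ω' : Fin n → Fin k, (∀ u, u ≠ v → ω u = ω' u) →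
      edgesIn G {u ∈ S | ω u = i} ≤ edgesIn G {u ∈ S | ω' u = i} + degIn G S v := by
    intro ω ω' h
    refine (edgesIn_le_erase G _ v).trans (Nat.add_le_add (edgesIn_mono G ?_)
      (degIn_mono G (Finset.filter_subset _ _) v))
    intro u hu
    obtain ⟨h1, h2⟩ := Finset.mem_erase.1 hu
    obtain ⟨h3, h4⟩ := Finset.mem_filter.1 h2
    exact Finset.mem_filter.2 ⟨h3, (h u h1) ▸ h4⟩
  split_ifs with hv
  · have h1 := key ω (Function.update ω v x) fun u hu => (Function.update_of_ne hu ..).symm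
    have h2 := key (Function.update ω v x) ω fun u hu => Function.update_of_ne hu ..
    rw [abs_le]
    have h1' : (edgesIn G {u ∈ S | ω u = i} : ℝ) ≤
      edgesIn G {u ∈ S | Function.update ω v x u = i} + degIn G S v := by exact_mod_cast h1
    have h2' : (edgesIn G {u ∈ S | Function.update ω v x u = i} : ℝ) ≤
      edgesIn G {u ∈ S | ω u = i} + degIn G S v := by exact_mod_cast h2
    constructor <;> linarith
  · have : ({u ∈ S | Function.update ω v x u = i} : Finset (Fin n)) = {u ∈ S | ω u = i} := by
      refine Finset.filter_congr fun u hu => ?_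
      rw [Function.update_of_ne (by rintro rfl; exact hv hu)]
    rw [this]
    simp

/-- The labellings form a box with two coordinates fixed. Multiplying by `k ^ 2` avoids the exponent
`n - 2`. -/
theorem card_labels_mul_sq {u v : Fin n} (huv : u ≠ v) (i : Fin k) :
    ({ω : Fin n → Fin k | ω u = i ∧ ω v = i} : Finset _).card * k ^ 2 = k ^ n := by
  classical
  have h1 : ({ω : Fin n → Fin k | ω u = i ∧ ω v = i} : Finset _) =
      Fintype.piFinset fun w => if w = u ∨ w = v then {i} else Finset.univ := by
    ext ω
    simp only [Finset.mem_filter, Finset.mem_univ, true_and, Fintype.mem_piFinset]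
    constructor
    · rintro ⟨h1, h2⟩ w
      split_ifs with h
      · rcases h with rfl | rfl <;> simpa
      · simp
    · intro h
      exact ⟨by simpa using h u, by simpa using h v⟩
  have hv : v ∈ Finset.univ.erase u := by simp [huv.symm]
  have h2 : ∏ w ∈ (Finset.univ.erase u).erase v,
      (if w = u ∨ w = v then ({i} : Finset (Fin k)) else Finset.univ).card =
      ∏ w ∈ (Finset.univ.erase u).erase v, k := by
    refine Finset.prod_congr rfl fun w hw => ?_
    simp only [Finset.mem_erase] at hw
    simp [hw.1, hw.2.1]
  have h3 : k ^ n = ∏ w : Fin n, k := by simp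
  rw [h1, Fintype.card_piFinset, h3, ← Finset.mul_prod_erase _ _ (Finset.mem_univ u),
    ← Finset.mul_prod_erase _ _ hv, ← Finset.mul_prod_erase _ _ (Finset.mem_univ u),
    ← Finset.mul_prod_erase _ _ hv, h2]
  simp
  ring

/-- Linearity of expectation over ordered adjacent pairs, with denominators cleared: the mean is `e
/ k²`. -/
theorem sum_edgesIn_filter (G : SimpleGraph (Fin n)) (S : Finset (Fin n)) (i : Fin k) :
    (∑ ω : Fin n → Fin k, edgesIn G {u ∈ S | ω u = i}) * k ^ 2 = edgesIn G S * k ^ n := by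
  classical
  have h1 : ∀ ω : Fin n → Fin k, 2 * edgesIn G {u ∈ S | ω u = i} =
      ∑ p ∈ {p ∈ S ×ˢ S | G.Adj p.1 p.2}, if ω p.1 = i ∧ ω p.2 = i then 1 else 0 := by
    intro ω
    rw [← card_filter_adj, ← Finset.card_filter]
    congr 1
    ext p
    simp only [Finset.mem_filter, Finset.mem_product]
    tauto
  have h2 : 2 * ((∑ ω : Fin n → Fin k, edgesIn G {u ∈ S | ω u = i}) * k ^ 2) =
      2 * (edgesIn G S * k ^ n) := by
    rw [← mul_assoc, Finset.mul_sum, Finset.sum_congr rfl fun ω _ => h1 ω, Finset.sum_comm,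
      Finset.sum_mul, ← mul_assoc, ← card_filter_adj, ← smul_eq_mul, ← Finset.sum_const]
    refine Finset.sum_congr (by congr) fun p hp => ?_
    rw [← Finset.card_filter, card_labels_mul_sq (Finset.mem_filter.1 hp).2.ne]
  omega

/-- This is where Stage I pays off: one factor of each square is bounded by the threshold, and the
other factors sum to `2 e`. -/
theorem sum_sq_degIn_le (G : SimpleGraph (Fin n)) (k : ℕ) :
    ∑ v, (if v ∈ survivors G k Finset.univ then (degIn G (survivors G k Finset.univ) v : ℝ)
      else 0) ^ 2 ≤ 2 * edgesIn G (survivors G k Finset.univ) *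
        threshold G k (survivors G k Finset.univ) := by
  set S := survivors G k Finset.univ with hS
  calc _ = ∑ v ∈ S, (degIn G S v : ℝ) ^ 2 := by
        rw [← Finset.sum_filter_add_sum_filter_not Finset.univ (· ∈ S)]
        rw [Finset.sum_congr rfl fun v hv => by rw [if_pos (Finset.mem_filter.1 hv).2],
          Finset.sum_eq_zero (s := Finset.filter (fun v => ¬ v ∈ S) Finset.univ) fun v hv => by
            rw [if_neg (Finset.mem_filter.1 hv).2]; simp]
        simp
    _ ≤ ∑ v ∈ S, (degIn G S v : ℝ) * threshold G k S := by
        refine Finset.sum_le_sum fun v hv => ?_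
        rw [sq]
        exact mul_le_mul_of_nonneg_left (degIn_survivors_le G k _ v hv) (Nat.cast_nonneg _)
    _ = _ := by
        rw [← Finset.sum_mul]
        congr 1
        exact_mod_cast sum_degIn G S

theorem card_unbalanced_le (hn : 2 ≤ n) (hk : 1 ≤ k) (G : SimpleGraph (Fin n)) (i : Fin k)
    {r : ℝ} (hr : 0 ≤ r) :
    (({ω : Fin n → Fin k | (1 + 2 * r) * G.edgeSet.ncard / (k : ℝ) ^ 2 <
      edgesIn G (bucket G k ω i)} : Finset _).card : ℝ) ≤
      (k : ℝ) ^ n * exp (-(r ^ 2 * Nat.clog 2 n)) := by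
  classical
  have : Nonempty (Fin k) := ⟨i⟩
  simp only [bucket_eq_filter]
  set S := survivors G k Finset.univ with hS
  have hk0 : (0 : ℝ) < k := by exact_mod_cast hk
  have hL : (0 : ℝ) < Nat.clog 2 n := by exact_mod_cast Nat.clog_pos (by simp) hn
  set L : ℝ := (Nat.clog 2 n : ℝ) with hLdef
  have hm : (edgesIn G S : ℝ) ≤ G.edgeSet.ncard := by
    rw [← edgesIn_univ]
    exact_mod_cast edgesIn_mono G (Finset.subset_univ S)
  -- The case without edges is split off because the exponential parameter divides by their number.
  rcases Nat.eq_zero_or_pos (edgesIn G S) with he | he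
  · rw [Finset.card_eq_zero.2]
    · simp only [Nat.cast_zero]
      positivity
    · refine Finset.filter_eq_empty_iff.2 fun ω _ hlt => ?_
      have h1 := edgesIn_mono G (Finset.filter_subset (fun u => ω u = i) S)
      rw [he, Nat.le_zero] at h1
      rw [h1, Nat.cast_zero] at hlt
      have : 0 ≤ (1 + 2 * r) * G.edgeSet.ncard / (k : ℝ) ^ 2 := by positivity
      linarith
  · have he' : (0 : ℝ) < edgesIn G S := by exact_mod_cast he
    set e : ℝ := (edgesIn G S : ℝ) with hedef
    -- This is the optimal Chernoff parameter, the deviation `2 r e / k²` divided by the variance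
    -- proxy `2 e² / (k⁴ L)`; it makes the exponent exactly `-r² L`.
    set s := r * L * k ^ 2 / e with hs
    have hs0 : 0 ≤ s := by positivity
    have hmom := sum_exp_le_of_boundedDifferences s
      (f := fun ω : Fin n → Fin k => (edgesIn G {u ∈ S | ω u = i} : ℝ))
      (fun ω v x => abs_edgesIn_filter_sub_le G S ω i v x)
    rw [Fintype.card_fin] at hmom
    have hmean : (∑ ω : Fin n → Fin k, (edgesIn G {u ∈ S | ω u = i} : ℝ)) / (k : ℝ) ^ n =
        e / (k : ℝ) ^ 2 := by
      rw [div_eq_div_iff (by positivity) (by positivity)]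
      rw [hedef]
      exact_mod_cast sum_edgesIn_filter G S i
    have hvar := sum_sq_degIn_le G k
    rw [← hS, threshold, Fintype.card_fin, ← hLdef, ← hedef] at hvar
    set Z := ∑ v, (if v ∈ S then (degIn G S v : ℝ) else 0) ^ 2 with hZ
    have hexpo : s * (e / (k : ℝ) ^ 2) + s ^ 2 * Z / 2 ≤
        s * ((1 + 2 * r) * e / (k : ℝ) ^ 2) + -(r ^ 2 * L) := by
      have h1 : s ^ 2 * Z / 2 ≤ s ^ 2 * (2 * e * (e / ((k : ℝ) ^ 4 * L))) / 2 := by gcongr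
      have h2 : s ^ 2 * (2 * e * (e / ((k : ℝ) ^ 4 * L))) / 2 = r ^ 2 * L := by
        rw [hs]; field_simp
      have h3 : s * ((1 + 2 * r) * e / (k : ℝ) ^ 2) = s * (e / (k : ℝ) ^ 2) + 2 * (r ^ 2 * L) := by
        rw [hs]; field_simp
      linarith
    rw [hmean] at hmom
    set E := exp (s * ((1 + 2 * r) * e / (k : ℝ) ^ 2)) with hE
    have hEpos : 0 < E := exp_pos _
    refine le_of_mul_le_mul_right ?_ hEpos
    calc _ = ∑ ω ∈ {ω : Fin n → Fin k | (1 + 2 * r) * G.edgeSet.ncard / (k : ℝ) ^ 2 <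
            edgesIn G {u ∈ S | ω u = i}}, E := by rw [Finset.sum_const, nsmul_eq_mul]
      _ ≤ ∑ ω ∈ {ω : Fin n → Fin k | (1 + 2 * r) * G.edgeSet.ncard / (k : ℝ) ^ 2 <
            edgesIn G {u ∈ S | ω u = i}}, exp (s * edgesIn G {u ∈ S | ω u = i}) := by
          refine Finset.sum_le_sum fun ω hω => exp_le_exp.2 ?_
          refine mul_le_mul_of_nonneg_left (le_trans ?_ (Finset.mem_filter.1 hω).2.le) hs0
          gcongr
      _ ≤ ∑ ω : Fin n → Fin k, exp (s * edgesIn G {u ∈ S | ω u = i}) :=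
          Finset.sum_le_sum_of_subset_of_nonneg (Finset.subset_univ _)
            fun _ _ _ => (exp_pos _).le
      _ ≤ (k : ℝ) ^ n * exp (s * (e / (k : ℝ) ^ 2) + s ^ 2 * Z / 2) := hmom
      _ ≤ (k : ℝ) ^ n * exp (s * ((1 + 2 * r) * e / (k : ℝ) ^ 2) + -(r ^ 2 * L)) := by gcongr
      _ = _ := by rw [exp_add]; ring

theorem one_sub_le_measure_balanced (hn : 2 ≤ n) (hk : 1 ≤ k) (G : SimpleGraph (Fin n))
    {r : ℝ} (hr : 0 ≤ r) :
    1 - k * exp (-(r ^ 2 * Nat.clog 2 n)) ≤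
      (ProbabilityTheory.uniformOn (Set.univ : Set (Fin n → Fin k))).real
        {ω | ∀ i, (edgesIn G (bucket G k ω i) : ℝ) ≤
          (1 + 2 * r) * G.edgeSet.ncard / (k : ℝ) ^ 2} := by
  classical
  have hk0 : (0 : ℝ) < k := by exact_mod_cast hk
  set good : Finset (Fin n → Fin k) := {ω | ∀ i, (edgesIn G (bucket G k ω i) : ℝ) ≤
          (1 + 2 * r) * G.edgeSet.ncard / (k : ℝ) ^ 2} with hgood
  have h1 : (ProbabilityTheory.uniformOn (Set.univ : Set (Fin n → Fin k))).real
        {ω | ∀ i, (edgesIn G (bucket G k ω i) : ℝ) ≤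
          (1 + 2 * r) * G.edgeSet.ncard / (k : ℝ) ^ 2} = good.card / (k : ℝ) ^ n := by
    rw [MeasureTheory.measureReal_def, ProbabilityTheory.uniformOn_univ,
      show {ω | ∀ i, (edgesIn G (bucket G k ω i) : ℝ) ≤
          (1 + 2 * r) * G.edgeSet.ncard / (k : ℝ) ^ 2} = (good : Set (Fin n → Fin k)) by
        ext; simp [hgood], MeasureTheory.Measure.count_apply_finset]
    simp
  have h2 : (Finset.univ \ good : Finset (Fin n → Fin k)) ⊆ Finset.univ.biUnion fun i =>
      ({ω : Fin n → Fin k | (1 + 2 * r) * G.edgeSet.ncard / (k : ℝ) ^ 2 <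
      edgesIn G (bucket G k ω i)} : Finset _) := by
    intro ω hω
    simpa [hgood] using hω
  have h3 : ((Finset.univ \ good : Finset (Fin n → Fin k)).card : ℝ) ≤
      k * ((k : ℝ) ^ n * exp (-(r ^ 2 * Nat.clog 2 n))) := by
    refine (Nat.cast_le.2 ((Finset.card_le_card h2).trans Finset.card_biUnion_le)).trans ?_
    -- Union bound over the `k` buckets.
    push_cast
    refine (Finset.sum_le_sum fun i _ => card_unbalanced_le hn hk G i hr).trans ?_
    simp
  have h4 := Finset.card_sdiff_add_card_eq_card (Finset.subset_univ good)
  have h5 : ((Finset.univ \ good : Finset (Fin n → Fin k)).card : ℝ) + good.card = (k : ℝ) ^ n := by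
    rw [Finset.card_univ, Fintype.card_fun, Fintype.card_fin, Fintype.card_fin] at h4
    exact_mod_cast h4
  have hpos : (0 : ℝ) < (k : ℝ) ^ n := by positivity
  rw [h1, le_div_iff₀ hpos]
  nlinarith

end CulledPartition

/-! ### Word length, comparison of logarithms and the choice of constants. -/

namespace CulledPartition

open Real

/-- The largest number is of order `n² k⁴`, of degree six; the remaining factor `(n + k)² ≥ 9`
absorbs the constant. -/
theorem wordBound_of_pow_le {n k W : ℕ} (hn : 2 ≤ n) (hk : 1 ≤ k) (h : (n + k) ^ 8 ≤ W) :
    WordBound n k W := by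
  have h3 : 3 ≤ n + k := by omega
  have hW : ∀ x < (n + k) ^ 8, x < W := fun x hx => hx.trans_le h
  have hnk : n ^ 2 ≤ (n + k) ^ 2 := Nat.pow_le_pow_left (by omega) 2
  have hkn : k ^ 4 ≤ (n + k) ^ 4 := Nat.pow_le_pow_left (by omega) 4
  have h9 : 9 ≤ (n + k) ^ 2 := by nlinarith
  have hpos : 0 < n ^ 2 := by positivity
  refine ⟨hn, hk, hW _ ?_, hW _ ?_⟩
  · calc 4 * (n * n) = 4 * n ^ 2 := by ring
      _ < 9 * n ^ 2 := by omega
      _ ≤ (n + k) ^ 2 * (n + k) ^ 2 := Nat.mul_le_mul h9 hnk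
      _ = (n + k) ^ 4 := by ring
      _ ≤ (n + k) ^ 8 := Nat.pow_le_pow_right (by omega) (by omega)
  · have hL : Nat.clog 2 n ≤ n := by
      rw [Nat.clog_le_iff_le_pow (by simp)]
      exact Nat.lt_two_pow_self.le
    have h1 : 0 < n ^ 2 * k ^ 4 := by positivity
    calc 2 * (n * (2 * k ^ 4 * Nat.clog 2 n)) ≤ 2 * (n * (2 * k ^ 4 * n)) := by gcongr
      _ = 4 * (n ^ 2 * k ^ 4) := by ring
      _ < 9 * (n ^ 2 * k ^ 4) := by omega
      _ ≤ (n + k) ^ 2 * ((n + k) ^ 2 * (n + k) ^ 4) :=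
          Nat.mul_le_mul h9 (Nat.mul_le_mul hnk hkn)
      _ = (n + k) ^ 8 := by ring

theorem log_le_clog {n : ℕ} (hn : 2 ≤ n) : log n ≤ Nat.clog 2 n := by
  have h1 : (n : ℝ) ≤ (2 : ℝ) ^ Nat.clog 2 n := by
    exact_mod_cast Nat.le_pow_clog (b := 2) (by simp) n
  have h2 : log n ≤ Nat.clog 2 n * log 2 := by
    rw [← log_pow]
    exact log_le_log (by positivity) h1
  refine h2.trans (mul_le_of_le_one_right (Nat.cast_nonneg _) ?_)
  linarith [log_two_lt_d9]

theorem clog_le_log {n : ℕ} (hn : 2 ≤ n) : (Nat.clog 2 n : ℝ) ≤ 4 * log n := by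
  have hL : 0 < Nat.clog 2 n := Nat.clog_pos (by simp) hn
  have h1 : (2 : ℝ) ^ Nat.clog 2 n ≤ 2 * n := by
    exact_mod_cast (Nat.two_pow_clog_lt (by omega : 0 < n)).le
  have h2 : Nat.clog 2 n * log 2 ≤ log 2 + log n := by
    rw [← log_pow, ← log_mul (by simp) (by positivity)]
    exact log_le_log (by positivity) h1
  -- Hence `L log 2 ≤ 2 log n`, and `log 2 > 1 / 2` yields the factor `4`.
  have h3 : log 2 ≤ log n := log_le_log (by simp) (by exact_mod_cast hn)
  have h4 := log_two_gt_d9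
  nlinarith [(Nat.cast_nonneg (Nat.clog 2 n) : (0 : ℝ) ≤ _)]

theorem card_culledSet_le {n k : ℕ} (hn : 2 ≤ n) (hk : 1 ≤ k) (G : SimpleGraph (Fin n)) :
    (culledSet G k).card ≤ 12 * k ^ 4 * Nat.clog 2 n ^ 2 := by
  have h1 := card_sdiff_survivors_le G hk (by simpa using hn) Finset.univ
  rw [Fintype.card_fin] at h1
  have h2 := log_edgesIn_le (by omega) G Finset.univ
  have hL : 0 < Nat.clog 2 n := Nat.clog_pos (by simp) hn
  refine le_trans (le_of_eq ?_) (h1.trans ?_)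
  · congr 1
  calc _ ≤ 4 * k ^ 4 * Nat.clog 2 n * (3 * Nat.clog 2 n) := Nat.mul_le_mul_left _ (by omega)
    _ = _ := by ring

/-- A polylogarithmic number is at most a power of `n`. -/
theorem exists_polylog_le_rpow (a : ℕ) (K : ℝ) :
    ∃ q : ℝ, 0 ≤ q ∧ ∀ n : ℕ, 2 ≤ n → K * log n ^ a ≤ (n : ℝ) ^ q := by
  obtain ⟨j, hj⟩ := pow_unbounded_of_one_lt K (one_lt_two : (1 : ℝ) < 2)
  refine ⟨(j + a : ℕ), Nat.cast_nonneg _, fun n hn => ?_⟩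
  have hn2 : (2 : ℝ) ≤ n := by exact_mod_cast hn
  have h0 : 0 ≤ log n := log_nonneg (by linarith)
  have h1 : log n ≤ n := log_le_self (by linarith)
  rw [rpow_natCast, pow_add]
  calc K * log n ^ a ≤ 2 ^ j * log n ^ a := by gcongr
    _ ≤ (n : ℝ) ^ j * (n : ℝ) ^ a := by gcongr

/-- The size of `C` and the partition property hold for every outcome, so only the balance condition
is random. -/
theorem isCulledBalancedPartition_iff {n k : ℕ} (G : SimpleGraph (Fin n)) (ω : Fin n → Fin k)
    {s D : ℝ} (hs : ((culledSet G k).card : ℝ) ≤ s) :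
    IsCulledBalancedPartition G (culledSet G k) (bucket G k ω) s D ↔
      ∀ i, (edgesIn G (bucket G k ω i) : ℝ) ≤ D * G.edgeSet.ncard / (k : ℝ) ^ 2 := by
  refine ⟨fun h => h.balanced, fun h => ⟨hs, ?_, ?_, h⟩⟩
  · intro i j hij
    refine Finset.disjoint_left.2 fun v h1 h2 => hij ?_
    simp only [bucket, Finset.mem_filter] at h1 h2
    exact h1.2.2.symm.trans h2.2.2
  · ext v
    simp [bucket]

end CulledPartition

open CulledPartition in
theorem mainTheorem3 :
    ∃ (prog : ParRAM.Prog) (A c : ℕ), ∀ (a : ℕ) (K : ℝ), ∃ (b : ℕ) (B : ℝ),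
      ∀ γ : ℝ, 0 < γ → ∃ D : ℝ,
        ∀ n k : ℕ, 2 ≤ n → 1 ≤ k → (k : ℝ) ≤ K * Real.log n ^ a →
          ∀ G : SimpleGraph (Fin n),
            (∀ off adj : ℕ → ℕ, CulledPartition.IsAdjacencyArray G off adj →
              ∀ W : ℕ, (n + k) ^ c ≤ W → ∀ ω : Fin n → Fin k,
                ∃ (s : ParRAM.State) (p : ParRAM.Cost),
                  ParRAM.Exec W (CulledPartition.tape ω) prog
                    (CulledPartition.input n k off adj) s p ∧
                  CulledPartition.outCulled n s = CulledPartition.culledSet G k ∧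
                  (∀ i, CulledPartition.outBucket n k s i = CulledPartition.bucket G k ω i) ∧
                  p.work ≤ A * (n + G.edgeSet.ncard) ∧
                  (p.depth : ℝ) ≤ B * Real.log n ^ b) ∧
            1 - (n : ℝ) ^ (-γ) ≤
              (ProbabilityTheory.uniformOn (Set.univ : Set (Fin n → Fin k))).real
                {ω | CulledPartition.IsCulledBalancedPartition G
                  (CulledPartition.culledSet G k) (CulledPartition.bucket G k ω)
                  (B * Real.log n ^ b) D} := by
  -- One polylogarithmic bound serves both the depth and `|C|`: each is at most `20000 k⁴ L²`, and
  -- `k ≤ K (log n) ^ a` and `L ≤ 4 log n` give `320000 = 20000 * 4 ^ 2`.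
  refine ⟨algorithm, 6000, 8, fun a K => ⟨4 * a + 2, 320000 * K ^ 4, fun γ hγ => ?_⟩⟩
  obtain ⟨q, hq, hpoly⟩ := exists_polylog_le_rpow a K
  -- The summand `q` pays for the union bound over `k ≤ n ^ q` buckets; the `1` ensures `r² ≥ r ≥ γ
  -- + q`.
  set r := γ + q + 1 with hr
  refine ⟨1 + 2 * r, fun n k hn hk hkK G => ?_⟩
  have hn2 : (2 : ℝ) ≤ n := by exact_mod_cast hn
  have hk1 : (1 : ℝ) ≤ k := by exact_mod_cast hk
  have hlog : 0 < Real.log n := Real.log_pos (by linarith)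
  have hclog := clog_le_log hn
  have hbound : 20000 * (k : ℝ) ^ 4 * (Nat.clog 2 n : ℝ) ^ 2 ≤
      320000 * K ^ 4 * Real.log n ^ (4 * a + 2) := by
    calc 20000 * (k : ℝ) ^ 4 * (Nat.clog 2 n : ℝ) ^ 2
        ≤ 20000 * (K * Real.log n ^ a) ^ 4 * (4 * Real.log n) ^ 2 := by gcongr
      _ = _ := by ring
  have hL2 : (0 : ℝ) ≤ (Nat.clog 2 n : ℝ) ^ 2 := by positivity
  refine ⟨fun off adj hadj W hW ω => ?_, ?_⟩
  · obtain ⟨t, p, h1, h2, h3, h4, h5⟩ := exec_algorithm (ω := ω) (wordBound_of_pow_le hn hk hW) hadj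
    refine ⟨t, p, h1, h2, h3, h4, le_trans ?_ hbound⟩
    have h6 : (p.depth : ℝ) ≤ 20000 * (Nat.clog 2 n : ℝ) ^ 2 := by exact_mod_cast h5
    have h7 : (1 : ℝ) ≤ (k : ℝ) ^ 4 := one_le_pow₀ hk1
    nlinarith
  · have hcard : ((culledSet G k).card : ℝ) ≤ 320000 * K ^ 4 * Real.log n ^ (4 * a + 2) := by
      have h1 : ((culledSet G k).card : ℝ) ≤ 12 * (k : ℝ) ^ 4 * (Nat.clog 2 n : ℝ) ^ 2 := by
        exact_mod_cast card_culledSet_le hn hk G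
      have h2 : 0 ≤ (k : ℝ) ^ 4 * (Nat.clog 2 n : ℝ) ^ 2 := by positivity
      linarith
    simp only [isCulledBalancedPartition_iff G _ hcard]
    refine le_trans ?_ (one_sub_le_measure_balanced hn hk G (r := r) (by positivity))
    have h1 : Real.exp (-(r ^ 2 * Nat.clog 2 n)) ≤ (n : ℝ) ^ (-(γ + q)) := by
      rw [Real.rpow_def_of_pos (by linarith), Real.exp_le_exp]
      have h2 := log_le_clog hn
      have h3 : γ + q ≤ r ^ 2 := by nlinarith
      have h4 : Real.log n * (γ + q) ≤ Nat.clog 2 n * r ^ 2 :=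
        mul_le_mul h2 h3 (by positivity) (Nat.cast_nonneg _)
      linarith
    have h2 : k * Real.exp (-(r ^ 2 * Nat.clog 2 n)) ≤ (n : ℝ) ^ (-γ) := by
      calc _ ≤ (n : ℝ) ^ q * (n : ℝ) ^ (-(γ + q)) :=
            mul_le_mul (hkK.trans (hpoly n hn)) h1 (Real.exp_pos _).le (by positivity)
        _ = (n : ℝ) ^ (-γ) := by
            rw [← Real.rpow_add (by linarith)]
            congr 1
            ring
    linarith
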